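/- Let $n\ge 1$, $\hbar>0$, write $z=(x,p)\in\mathbb R^{2n}=\mathbb R^n_x\oplus\mathbb R^n_p$, let $R$ be a real symmetric $2n\times 2n$ matrix, $H(z)=\frac12 Rz\cdot z$, $J=\begin{pmatrix}0&I\\-I&0\end{pmatrix}$ and $S_t=e^{tJR}$. *Definitions.* A quantum blob is a set $\mathcal{QB}^{2n}(z_0,S)=z_0+S\,B(\sqrt\hbar)$, where $z_0\in\mathbb R^{2n}$, $S\in\mathrm{Sp}(2n,\mathbb R)$, and $B(\sqrt\hbar)$ is the closed ball of radius $\sqrt\hbar$ centred at $0$. A squeezed coherent state is a function in $L^2(\mathbb R^n)$ of the form $$e^{\frac i\hbar\gamma}\,e^{\frac i\hbar(p_0\cdot x-\frac12p_0\cdot x_0)}\,\Phi_{X,Y}(x-x_0),\qquad \Phi_{X,Y}(x)=(\pi\hbar)^{-n/4}(\det X)^{1/4}e^{-\frac1{2\hbar}(X+iY)x\cdot x},$$ with $\gamma\in\mathbb R$, $(x_0,p_0)\in\mathbb R^{2n}$, and $X,Y$ real symmetric $n\times n$ matrices, $X$ positive definite. The Wigner transform of $\Psi$ is $$W\Psi(x,p)=(2\pi\hbar)^{-n}\int_{\mathbb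 R^n}e^{-\frac i\hbar p\cdot y}\,\Psi(x+\tfrac12y)\,\overline{\Psi(x-\tfrac12y)}\,dy .$$ A set $Q\subset\mathbb R^{2n}$ corresponds to $\Psi\in L^2(\mathbb R^n)$ if there are a real symmetric positive definite $2n\times2n$ matrix $G$ and $\bar z\in\mathbb R^{2n}$ such that $W\Psi(z)=(\pi\hbar)^{-n}e^{-\frac1\hbar G(z-\bar z)\cdot(z-\bar z)}$ for all $z$, and $Q=\{z: G(z-\bar z)\cdot(z-\bar z)\le\hbar\}$. The Weyl quantization of $H$ is the operator $\widehat H=\frac12\sum_{\alpha,\beta}R_{\alpha\beta}\,\frac12(\hat z_\alpha\hat z_\beta+\hat z_\beta\hat z_\alpha)$ on Schwartz functions, where $\hat x_j$ is multiplication by $x_j$ and $\hat p_j=-i\hbar\,\partial/\partial x_j$. A solution of Schrödinger's equation $i\hbar\,\partial_t\Psi=\widehat H\Psi$ is a continuous map $\Psi:\mathbb R\to L^2(\mathbb R^n)$ such that $i\hbar\frac{d}{dt}\langle\varphi,\Psi(t)\rangle=\langle\widehat H\varphi,\Psi(t)\rangle$ for all Schwartz functions $\varphi$ and all $t\in\mathbb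 R$. *Proposition.* 1. Each $S_t$ is symplectic, and $t\mapsto z_t$ solves Hamilton's equations $\dot x=\nabla_pH$, $\dot p=-\nabla_xH$ on $\mathbb R$ if and only if $z_t=S_tz_0$ for all $t$. 2. To every squeezed coherent state there corresponds exactly one set, which is a quantum blob; and every quantum blob corresponds to some squeezed coherent state. 3. Let $t\mapsto z_t$ be a solution of Hamilton's equations, let $S_0\in\mathrm{Sp}(2n,\mathbb R)$, and let $\Psi_0$ be a squeezed coherent state whose quantum blob is $\mathcal{QB}^{2n}(z_0,S_0)$. Then Schrödinger's equation has exactly one solution $\Psi$ with $\Psi(0)=\Psi_0$. For every $t\in\mathbb R$, $\Psi(t)$ is a squeezed coherent state, and the unique set that corresponds to it is the quantum blob $$S_t\big[\mathcal{QB}^{2n}(z_0,S_0)\big]=\mathcal{QB}^{2n}(z_t,\,S_tS_0).$$ So the quantum motion of coherent states induces the classical motion of the corresponding quantum blobs. -/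

import Mathlib

open MeasureTheory
open scoped Matrix SchwartzMap

noncomputable section

namespace QuantumBlobs

/-- Configuration space `ℝⁿ` with its Euclidean structure and Lebesgue measure. -/
abbrev ConfigSpace (n : ℕ) : Type := EuclideanSpace ℝ (Fin n)

/-- Phase space `ℝ²ⁿ = ℝⁿ ⊕ ℝⁿ`; the coordinate `Sum.inl j` is `x_j`, and `Sum.inr j` is `p_j`. -/
abbrev PhaseSpace (n : ℕ) : Type := EuclideanSpace ℝ (Fin n ⊕ Fin n)

variable {n : ℕ}

/-- The position component `x` of `z = (x, p)`. -/
def position (z : PhaseSpace n) : ConfigSpace n := WithLp.toLp 2 fun j => z (Sum.inl j)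

/-- The momentum component `p` of `z = (x, p)`. -/
def momentum (z : PhaseSpace n) : ConfigSpace n := WithLp.toLp 2 fun j => z (Sum.inr j)

/-- The quadratic form `A v · v` of a real matrix. -/
def quadForm {ι : Type*} [Fintype ι] (A : Matrix ι ι ℝ) (v : EuclideanSpace ℝ ι) : ℝ :=
  (A *ᵥ v.ofLp) ⬝ᵥ v.ofLp

/-! ### Classical mechanics -/

/-- The quadratic Hamiltonian `H(z) = ½ R z · z`. -/
def quadraticHamiltonian (R : Matrix (Fin n ⊕ Fin n) (Fin n ⊕ Fin n) ℝ) (z : PhaseSpace n) : ℝ :=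
  (1 / 2) * quadForm R z

/-- `z` solves Hamilton's equations `ẋ = ∇_p H`, `ṗ = -∇_x H` on the whole time axis. -/
def IsHamiltonTrajectory (H : PhaseSpace n → ℝ) (z : ℝ → PhaseSpace n) : Prop :=
  ∀ (t : ℝ) (j : Fin n),
    HasDerivAt (fun s => z s (Sum.inl j))
      (fderiv ℝ H (z t) (EuclideanSpace.single (Sum.inr j) 1)) t ∧
    HasDerivAt (fun s => z s (Sum.inr j))
      (-(fderiv ℝ H (z t) (EuclideanSpace.single (Sum.inl j) 1))) t

/-- The matrix `(0 I; -I 0)`, in which Hamilton's equations for `H(z) = ½ R z · z` read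
`ż = J₀ R z`. (Mathlib's `Matrix.J` is its negative; both define the same symplectic group.) -/
def standardJ (n : ℕ) : Matrix (Fin n ⊕ Fin n) (Fin n ⊕ Fin n) ℝ :=
  Matrix.fromBlocks 0 1 (-1) 0

/-- The matrix `S_t = exp (t J₀ R)` of the flow of `H(z) = ½ R z · z`. -/
def classicalFlow (R : Matrix (Fin n ⊕ Fin n) (Fin n ⊕ Fin n) ℝ) (t : ℝ) :
    Matrix (Fin n ⊕ Fin n) (Fin n ⊕ Fin n) ℝ :=
  NormedSpace.exp (t • (standardJ n * R))

/-- `T(z₀) S B(√ħ)`, the image of the closed ball of radius `√ħ` centred at `0`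
under the matrix `S`, translated by `z₀`. It is called a quantum blob when `S` is symplectic. -/
def quantumBlob (ħ : ℝ) (z₀ : PhaseSpace n)
    (S : Matrix (Fin n ⊕ Fin n) (Fin n ⊕ Fin n) ℝ) : Set (PhaseSpace n) :=
  (fun z => z + z₀) '' (Matrix.toEuclideanLin S '' Metric.closedBall 0 (Real.sqrt ħ))

/-! ### Squeezed coherent states and their Wigner transforms -/

/-- The centred Gaussian
`Φ_{X,Y}(x) = (πħ)^{-n/4} (det X)^{1/4} exp (-(1/2ħ) (X + iY) x · x)`. -/
def squeezedGaussian (ħ : ℝ) (X Y : Matrix (Fin n) (Fin n) ℝ) (x : ConfigSpace n) : ℂ :=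
  (((Real.pi * ħ) ^ (-(n : ℝ) / 4) * X.det ^ (1 / 4 : ℝ) : ℝ) : ℂ) *
    Complex.exp (-(1 / (2 * (ħ : ℂ))) * ((quadForm X x : ℂ) + Complex.I * (quadForm Y x : ℂ)))

/-- The Heisenberg--Weyl operator
`T̂(z₀) ψ (x) = exp ((i/ħ) (p₀ · x - ½ p₀ · x₀)) ψ (x - x₀)`. -/
def heisenbergWeyl (ħ : ℝ) (z₀ : PhaseSpace n) (ψ : ConfigSpace n → ℂ) (x : ConfigSpace n) : ℂ :=
  Complex.exp (Complex.I / (ħ : ℂ) *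
      ((inner ℝ (momentum z₀) x - (1 / 2) * inner ℝ (momentum z₀) (position z₀) : ℝ) : ℂ)) *
    ψ (x - position z₀)

/-- The Hilbert space `L²(ℝⁿ)` of wavefunctions. -/
abbrev StateSpace (n : ℕ) : Type := Lp ℂ 2 (volume : Measure (ConfigSpace n))

/-- `ψ = e^{iγ/ħ} T̂(z₀) Φ_{X,Y}` for some real phase `γ`, some `z₀`, some real symmetric `X`, `Y`,
with `X` positive definite. (For real matrices `Matrix.PosDef` includes symmetry.) -/
def IsSqueezedCoherentState (ħ : ℝ) (ψ : StateSpace n) : Prop :=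
  ∃ (X Y : Matrix (Fin n) (Fin n) ℝ) (z₀ : PhaseSpace n) (γ : ℝ), X.PosDef ∧ Y.IsSymm ∧
    ψ =ᵐ[volume] fun x =>
      Complex.exp (Complex.I / (ħ : ℂ) * (γ : ℂ)) * heisenbergWeyl ħ z₀ (squeezedGaussian ħ X Y) x

/-- The Wigner transform
`Wψ(x,p) = (2πħ)^{-n} ∫ e^{-(i/ħ) p · y} ψ(x + y/2) ψ(x - y/2)^* dy`. -/
def wigner (ħ : ℝ) (ψ : ConfigSpace n → ℂ) (z : PhaseSpace n) : ℂ :=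
  (1 / (2 * (Real.pi : ℂ) * (ħ : ℂ))) ^ n *
    ∫ y : ConfigSpace n,
      Complex.exp (-(Complex.I / (ħ : ℂ)) * ((inner ℝ (momentum z) y : ℝ) : ℂ)) *
        ψ (position z + (1 / 2 : ℝ) • y) *
        (starRingEnd ℂ) (ψ (position z - (1 / 2 : ℝ) • y))

/-- The correspondence between states with Gaussian Wigner transform and ellipsoids:
`Wψ(z) = (πħ)^{-n} exp (-(1/ħ) G(z - z₀) · (z - z₀))` for all `z`, and
`Q = {z | G(z - z₀) · (z - z₀) ≤ ħ}`. -/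
def CorrespondsTo (ħ : ℝ) (ψ : StateSpace n) (Q : Set (PhaseSpace n)) : Prop :=
  ∃ (G : Matrix (Fin n ⊕ Fin n) (Fin n ⊕ Fin n) ℝ) (z₀ : PhaseSpace n), G.PosDef ∧
    (∀ z : PhaseSpace n, wigner ħ ψ z =
      (((1 / (Real.pi * ħ)) ^ n * Real.exp (-(1 / ħ) * quadForm G (z - z₀)) : ℝ) : ℂ)) ∧
    Q = {z | quadForm G (z - z₀) ≤ ħ}

/-! ### Schrödinger's equation -/

/-- The quantized coordinates on Schwartz functions: `x̂_j` is multiplication by `x_j`, and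
`p̂_j = -iħ ∂/∂x_j`. -/
def quantizedCoord (ħ : ℝ) : Fin n ⊕ Fin n → (𝓢(ConfigSpace n, ℂ) →L[ℂ] 𝓢(ConfigSpace n, ℂ))
  | Sum.inl j => SchwartzMap.smulLeftCLM ℂ (fun x : ConfigSpace n => ((x j : ℝ) : ℂ))
  | Sum.inr j => (-(Complex.I * (ħ : ℂ))) •
      LineDeriv.lineDerivOpCLM ℂ 𝓢(ConfigSpace n, ℂ) (EuclideanSpace.single j (1 : ℝ))

theorem quantizedCoord_inl_apply (ħ : ℝ) (j : Fin n) (φ : 𝓢(ConfigSpace n, ℂ))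
    (x : ConfigSpace n) : quantizedCoord ħ (Sum.inl j) φ x = (x j : ℂ) * φ x := by
  have h : (fun x : ConfigSpace n => ((x j : ℝ) : ℂ)).HasTemperateGrowth :=
    (Complex.ofRealCLM.comp (EuclideanSpace.proj (𝕜 := ℝ) j)).hasTemperateGrowth
  simp [quantizedCoord, SchwartzMap.smulLeftCLM_apply_apply h]

theorem quantizedCoord_inr_apply (ħ : ℝ) (j : Fin n) (φ : 𝓢(ConfigSpace n, ℂ))
    (x : ConfigSpace n) : quantizedCoord ħ (Sum.inr j) φ x =
      -(Complex.I * (ħ : ℂ)) * lineDeriv ℝ φ x (EuclideanSpace.single j (1 : ℝ)) := by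
  simp [quantizedCoord, SchwartzMap.lineDerivOp_apply]

/-- The Weyl quantization of `H(z) = ½ R z · z = ½ ∑ R_{αβ} z_α z_β` on Schwartz functions: every
product `z_α z_β` is replaced by the symmetrized product `½ (ẑ_α ẑ_β + ẑ_β ẑ_α)`. -/
def weylHamiltonian (ħ : ℝ) (R : Matrix (Fin n ⊕ Fin n) (Fin n ⊕ Fin n) ℝ) :
    𝓢(ConfigSpace n, ℂ) →L[ℂ] 𝓢(ConfigSpace n, ℂ) :=
  (1 / 2 : ℂ) • ∑ α, ∑ β, (R α β : ℂ) • ((1 / 2 : ℂ) •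
    ((quantizedCoord ħ α).comp (quantizedCoord ħ β) +
      (quantizedCoord ħ β).comp (quantizedCoord ħ α)))

/-- `Ψ` is a (weak) solution in `C(ℝ, L²(ℝⁿ))` of Schrödinger's equation `iħ ∂Ψ/∂t = Ĥ Ψ`, where
`Ĥ` is the Weyl quantization of `½ R z · z`: the curve `Ψ` is continuous, and
`iħ (d/dt) ⟨φ, Ψ(t)⟩ = ⟨Ĥ φ, Ψ(t)⟩` for every `t` and every Schwartz function `φ`. -/
def IsSchrodingerSolution (ħ : ℝ) (R : Matrix (Fin n ⊕ Fin n) (Fin n ⊕ Fin n) ℝ)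
    (Ψ : ℝ → StateSpace n) : Prop :=
  Continuous Ψ ∧ ∀ (φ : 𝓢(ConfigSpace n, ℂ)) (t : ℝ),
    HasDerivAt (fun s => inner ℂ (φ.toLp 2 volume) (Ψ s))
      ((Complex.I * (ħ : ℂ))⁻¹ * inner ℂ ((weylHamiltonian ħ R φ).toLp 2 volume) (Ψ t)) t

end QuantumBlobs

end

/-!
A Gaussian `exp (a + b · x - (1/2ħ) M x · x)` is governed by the column space of the `2n × n` frame
`W = (1, iM)`, a complex Lagrangian subspace, so the symplectic group acts on the matrices
`M = X + iY`, which form the Siegel half-space. The matrix `G` of the Wigner transform is the only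
real matrix with `G W = -i J₀ W`. Hence replacing `M` by `S • M` replaces `G` by `S⁻ᵀ G S⁻¹`, and
this is how an ellipsoid changes under the linear map `S`.

Quantized coordinates act on a Gaussian by affine functions of `x`, so Schrödinger's equation for a
Gaussian becomes a system of ordinary differential equations for `(a, b, M)`. Its last component is
the Riccati equation `M' = i Wᵀ R W`, solved by `S_t • M`, and the centre moves by `S_t`; unitarity
then fixes the amplitude up to a phase. The solution is unique because the difference of two weak
solutions is orthogonal to every backward-evolved Gaussian, and the Gaussians with a fixed `M` are
total in `L²`.
-/

noncomputable section

namespace QuantumBlobs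

variable {n : ℕ}

/-! ### Quadratic forms -/

section QuadraticForms

variable {ι : Type*}

theorem isSymm_of_posDef {A : Matrix ι ι ℝ} (hA : A.PosDef) : A.IsSymm := by
  simpa [Matrix.IsHermitian, Matrix.IsSymm] using hA.isHermitian

variable [Fintype ι]

theorem quadForm_smul (A : Matrix ι ι ℝ) (c : ℝ) (v : EuclideanSpace ℝ ι) :
    quadForm A (c • v) = c ^ 2 * quadForm A v := by
  simp only [quadForm, WithLp.ofLp_smul, Matrix.mulVec_smul, smul_dotProduct, dotProduct_smul,
    smul_eq_mul]
  ring

theorem quadForm_neg (A : Matrix ι ι ℝ) (v : EuclideanSpace ℝ ι) :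
    quadForm A (-v) = quadForm A v := by
  simp [quadForm, Matrix.mulVec_neg]

theorem dotProduct_mulVec_symm {𝕜 : Type*} [CommRing 𝕜] {A : Matrix ι ι 𝕜} (hA : A.IsSymm)
    (u v : ι → 𝕜) : (A *ᵥ u) ⬝ᵥ v = u ⬝ᵥ (A *ᵥ v) := by
  rw [Matrix.dotProduct_mulVec, ← Matrix.mulVec_transpose, hA.eq]

theorem quadForm_add {A : Matrix ι ι ℝ} (hA : A.IsSymm) (u v : EuclideanSpace ℝ ι) :
    quadForm A (u + v) = quadForm A u + 2 * ((A *ᵥ u.ofLp) ⬝ᵥ v.ofLp) + quadForm A v := by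
  simp only [quadForm, WithLp.ofLp_add, Matrix.mulVec_add, add_dotProduct, dotProduct_add]
  rw [dotProduct_mulVec_symm hA v.ofLp u.ofLp, dotProduct_comm v.ofLp]
  ring

theorem hasFDerivAt_quadForm {A : Matrix ι ι ℝ} (hA : A.IsSymm) (z : EuclideanSpace ℝ ι) :
    HasFDerivAt (quadForm A) (2 • innerSL ℝ (WithLp.toLp 2 (A *ᵥ z.ofLp))) z := by
  classical
  have hinner : quadForm A =
      fun w => inner ℝ ((Matrix.toEuclideanLin A).toContinuousLinearMap w) w := by
    funext w
    simp [quadForm, EuclideanSpace.inner_eq_star_dotProduct, dotProduct_comm]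
  rw [hinner]
  refine ((Matrix.toEuclideanLin A).toContinuousLinearMap.hasFDerivAt.inner ℝ
    (hasFDerivAt_id z)).congr_fderiv ?_
  ext v
  simp [EuclideanSpace.inner_eq_star_dotProduct, two_mul,
    dotProduct_comm z.ofLp, dotProduct_mulVec_symm hA v.ofLp, dotProduct_comm v.ofLp]

variable [DecidableEq ι]

theorem toEuclideanLin_mul_apply (A B : Matrix ι ι ℝ) (v : EuclideanSpace ℝ ι) :
    Matrix.toEuclideanLin (A * B) v = Matrix.toEuclideanLin A (Matrix.toEuclideanLin B v) := by
  rw [Matrix.toLpLin_mul_same, LinearMap.comp_apply]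

theorem quadForm_congr (A S : Matrix ι ι ℝ) (v : EuclideanSpace ℝ ι) :
    quadForm (Sᵀ * A * S) v = quadForm A (Matrix.toEuclideanLin S v) := by
  simp only [quadForm, Matrix.ofLp_toLpLin, Matrix.toLin'_apply, ← Matrix.mulVec_mulVec]
  rw [Matrix.mulVec_transpose, ← Matrix.dotProduct_mulVec]

theorem quadForm_transpose_mul_self (S : Matrix ι ι ℝ) (v : EuclideanSpace ℝ ι) :
    quadForm (Sᵀ * S) v = ‖Matrix.toEuclideanLin S v‖ ^ 2 := by
  rw [← mul_one Sᵀ, quadForm_congr, EuclideanSpace.real_norm_sq_eq]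
  simp [quadForm, dotProduct, sq]

open MatrixOrder in
theorem exists_transpose_mul_self {A : Matrix ι ι ℝ} (hA : A.PosDef) :
    ∃ P : Matrix ι ι ℝ, IsUnit P.det ∧ A = Pᵀ * P := by
  obtain ⟨P, hP⟩ := CStarAlgebra.nonneg_iff_eq_star_mul_self.mp hA.posSemidef.nonneg
  have hAP : A = Pᵀ * P := by simpa [Matrix.star_eq_conjTranspose] using hP
  refine ⟨P, isUnit_of_mul_isUnit_right (x := Pᵀ.det) ?_, hAP⟩
  rw [← Matrix.det_mul, ← hAP]
  exact hA.det_pos.ne'.isUnit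

theorem posDef_transpose_mul_self {P : Matrix ι ι ℝ} (hP : IsUnit P.det) : (Pᵀ * P).PosDef := by
  simpa using Matrix.PosDef.conjTranspose_mul_self P
    (Matrix.mulVec_injective_iff_isUnit.2 ((Matrix.isUnit_iff_isUnit_det P).2 hP))

omit [DecidableEq ι] in
theorem exists_mul_norm_sq_le_quadForm {A : Matrix ι ι ℝ} (hA : A.PosDef) :
    ∃ c > 0, ∀ v : EuclideanSpace ℝ ι, c * ‖v‖ ^ 2 ≤ quadForm A v := by
  classical
  obtain ⟨P, hP, rfl⟩ := exists_transpose_mul_self hA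
  set T := (Matrix.toEuclideanLin P⁻¹).toContinuousLinearMap
  have hT (v) : T (Matrix.toEuclideanLin P v) = v := by
    simp [T, ← toEuclideanLin_mul_apply, Matrix.nonsing_inv_mul P hP]
  refine ⟨((‖T‖ + 1) ^ 2)⁻¹, by positivity, fun v => ?_⟩
  rw [quadForm_transpose_mul_self, inv_mul_le_iff₀ (by positivity), ← mul_pow]
  gcongr
  calc ‖v‖ = ‖T (Matrix.toEuclideanLin P v)‖ := by rw [hT]
    _ ≤ ‖T‖ * ‖Matrix.toEuclideanLin P v‖ := T.le_opNorm _
    _ ≤ (‖T‖ + 1) * ‖Matrix.toEuclideanLin P v‖ := by gcongr; linarith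

end QuadraticForms

/-! ### The classical flow -/

section MatrixCalculus

variable {ι κ l : Type*} {𝔸 : Type*} [NormedRing 𝔸] [NormedAlgebra ℝ 𝔸] {t : ℝ}

theorem hasDerivAt_matrix_iff [Finite ι] [Finite κ] {A : ℝ → Matrix ι κ 𝔸} {A' : Matrix ι κ 𝔸} :
    HasDerivAt A A' t ↔ ∀ i j, HasDerivAt (fun s => A s i j) (A' i j) t := by
  have := Fintype.ofFinite ι
  have := Fintype.ofFinite κ
  exact (hasDerivAt_pi (φ := A)).trans (forall_congr' fun _ => hasDerivAt_pi)

theorem hasDerivAt_matrix_const [Finite ι] [Finite κ] (A : Matrix ι κ 𝔸) (t : ℝ) :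
    HasDerivAt (fun _ => A) 0 t :=
  hasDerivAt_matrix_iff.2 fun i j => hasDerivAt_const t (A i j)

theorem hasDerivAt_matrix_mul [Finite ι] [Fintype κ] [Finite l] {A : ℝ → Matrix ι κ 𝔸}
    {B : ℝ → Matrix κ l 𝔸} {A' : Matrix ι κ 𝔸} {B' : Matrix κ l 𝔸} (hA : HasDerivAt A A' t)
    (hB : HasDerivAt B B' t) : HasDerivAt (fun s => A s * B s) (A' * B t + A t * B') t := by
  refine hasDerivAt_matrix_iff.2 fun i j => ?_
  have h := HasDerivAt.fun_sum (u := Finset.univ) fun k _ =>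
    (hasDerivAt_matrix_iff.1 hA i k).mul (hasDerivAt_matrix_iff.1 hB k j)
  simpa [Matrix.mul_apply, Finset.sum_add_distrib] using h

theorem hasDerivAt_mulVec [Finite ι] [Fintype κ] {A : ℝ → Matrix ι κ 𝔸} {A' : Matrix ι κ 𝔸}
    {v : ℝ → κ → 𝔸} {v' : κ → 𝔸} (hA : HasDerivAt A A' t) (hv : HasDerivAt v v' t) :
    HasDerivAt (fun s => A s *ᵥ v s) (A' *ᵥ v t + A t *ᵥ v') t := by
  have := Fintype.ofFinite ι
  refine hasDerivAt_pi.2 fun i => ?_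
  have h := HasDerivAt.fun_sum (u := Finset.univ) fun j _ =>
    (hasDerivAt_matrix_iff.1 hA i j).mul (hasDerivAt_pi.1 hv j)
  simpa [Matrix.mulVec, dotProduct, Finset.sum_add_distrib] using h

theorem hasDerivAt_dotProduct [Fintype ι] {u v : ℝ → ι → 𝔸} {u' v' : ι → 𝔸}
    (hu : HasDerivAt u u' t) (hv : HasDerivAt v v' t) :
    HasDerivAt (fun s => u s ⬝ᵥ v s) (u' ⬝ᵥ v t + u t ⬝ᵥ v') t := by
  have h := HasDerivAt.fun_sum (u := Finset.univ) fun i _ =>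
    (hasDerivAt_pi.1 hu i).mul (hasDerivAt_pi.1 hv i)
  simpa [dotProduct, Finset.sum_add_distrib] using h

variable {𝕜 : Type*} [RCLike 𝕜] [Fintype ι] [DecidableEq ι]

theorem exp_neg_smul_mul_exp_smul (K : Matrix ι ι 𝕜) (t : ℝ) :
    NormedSpace.exp (-t • K) * NormedSpace.exp (t • K) = 1 := by
  have hunit : IsUnit (NormedSpace.exp (t • K)) := Matrix.isUnit_exp (t • K)
  rw [neg_smul, Matrix.exp_neg,
    Matrix.nonsing_inv_mul _ ((Matrix.isUnit_iff_isUnit_det (NormedSpace.exp (t • K))).1 hunit)]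

section

attribute [local instance] Matrix.linftyOpNormedRing Matrix.linftyOpNormedAlgebra

theorem hasDerivAt_matrix_inv {A : ℝ → Matrix ι ι 𝕜} {A' : Matrix ι ι 𝕜} (hA : HasDerivAt A A' t)
    (hu : IsUnit (A t)) : HasDerivAt (fun s => (A s)⁻¹) (-((A t)⁻¹ * A' * (A t)⁻¹)) t := by
  obtain ⟨u, hu⟩ := hu
  have hinv : ((u⁻¹ : (Matrix ι ι 𝕜)ˣ) : Matrix ι ι 𝕜) = (A t)⁻¹ := by
    rw [← hu, Matrix.coe_units_inv]
  have hring := hasFDerivAt_ringInverse (𝕜 := ℝ) u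
  rw [hu] at hring
  have hcomp := hring.comp_hasDerivAt t hA
  simp only [Function.comp_def, ← Matrix.nonsing_inv_eq_ringInverse, hinv, neg_apply,
    ContinuousLinearMap.mulLeftRight_apply] at hcomp
  exact hcomp

theorem hasDerivAt_exp_smul (K : Matrix ι ι 𝕜) (t : ℝ) :
    HasDerivAt (fun s : ℝ => NormedSpace.exp (s • K)) (K * NormedSpace.exp (t • K)) t :=
  hasDerivAt_exp_smul_const' K t

theorem hasDerivAt_exp_neg_smul (K : Matrix ι ι 𝕜) (t : ℝ) :
    HasDerivAt (fun s : ℝ => NormedSpace.exp (-s • K)) (-(NormedSpace.exp (-t • K) * K)) t := by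
  have hcomp := (hasDerivAt_exp_smul_const K (-t)).scomp t (hasDerivAt_neg t)
  rw [neg_one_smul] at hcomp
  exact hcomp

end

theorem forall_hasDerivAt_mulVec_iff (K : Matrix ι ι 𝕜) (z : ℝ → ι → 𝕜) :
    (∀ t, HasDerivAt z (K *ᵥ z t) t) ↔ ∀ t : ℝ, z t = NormedSpace.exp (t • K) *ᵥ z 0 := by
  constructor
  · intro hz t
    have hconst : ∀ s, HasDerivAt (fun s : ℝ => NormedSpace.exp (-s • K) *ᵥ z s) 0 s := by
      intro s
      convert! hasDerivAt_mulVec (hasDerivAt_exp_neg_smul K s) (hz s) using 1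
      rw [Matrix.mulVec_mulVec, ← Matrix.add_mulVec, neg_add_cancel, Matrix.zero_mulVec]
    have ht := is_const_of_deriv_eq_zero (fun s => (hconst s).differentiableAt)
      (fun s => (hconst s).deriv) t 0
    simp only [neg_zero, zero_smul, NormedSpace.exp_zero, Matrix.one_mulVec] at ht
    simpa [← ht, Matrix.mulVec_mulVec] using
      congr($(exp_neg_smul_mul_exp_smul K (-t)) *ᵥ z t).symm
  · intro hz t
    rw [funext hz]
    simpa [Matrix.mulVec_mulVec] using
      hasDerivAt_mulVec (hasDerivAt_exp_smul K t) (hasDerivAt_const t (z 0))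

end MatrixCalculus

section Classical

theorem exp_mem_symplecticGroup {l : Type*} [Fintype l] [DecidableEq l]
    {K : Matrix (l ⊕ l) (l ⊕ l) ℝ} (hK : Kᵀ * Matrix.J l ℝ = -(Matrix.J l ℝ * K)) :
    NormedSpace.exp K ∈ Matrix.symplecticGroup l ℝ := by
  set J := Matrix.J l ℝ
  have hJ : IsUnit J.det := Matrix.isUnit_det_J l ℝ
  have hKT : Kᵀ = J * -K * J⁻¹ := by
    rw [mul_neg, ← hK, mul_assoc, Matrix.mul_nonsing_inv _ hJ, mul_one]
  have hexpK : IsUnit (NormedSpace.exp K).det :=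
    (Matrix.isUnit_iff_isUnit_det _).1 (Matrix.isUnit_exp K)
  rw [SymplecticGroup.mem_iff', ← Matrix.exp_transpose, hKT,
    Matrix.exp_conj _ _ ((Matrix.isUnit_iff_isUnit_det J).2 hJ), Matrix.exp_neg]
  change J * (NormedSpace.exp K)⁻¹ * J⁻¹ * J * NormedSpace.exp K = J
  rw [Matrix.nonsing_inv_mul_cancel_right _ _ hJ, Matrix.nonsing_inv_mul_cancel_right _ _ hexpK]

theorem standardJ_eq_neg_J (n : ℕ) : standardJ n = -Matrix.J (Fin n) ℝ := by
  simp [standardJ, Matrix.J, Matrix.fromBlocks_neg]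

theorem transpose_mul_standardJ_mul {S : Matrix (Fin n ⊕ Fin n) (Fin n ⊕ Fin n) ℝ}
    (hS : S ∈ Matrix.symplecticGroup (Fin n) ℝ) : Sᵀ * standardJ n * S = standardJ n := by
  simp [standardJ_eq_neg_J, SymplecticGroup.mem_iff'.1 hS]

variable {R : Matrix (Fin n ⊕ Fin n) (Fin n ⊕ Fin n) ℝ}

theorem classicalFlow_mem_symplecticGroup (hR : R.IsSymm) (t : ℝ) :
    classicalFlow R t ∈ Matrix.symplecticGroup (Fin n) ℝ := by
  refine exp_mem_symplecticGroup ?_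
  simp [standardJ_eq_neg_J, hR.eq, mul_assoc, Matrix.J_squared, ← mul_assoc (Matrix.J (Fin n) ℝ)]

theorem fderiv_quadraticHamiltonian_single (hR : R.IsSymm) (z : PhaseSpace n) (α : Fin n ⊕ Fin n) :
    fderiv ℝ (quadraticHamiltonian R) z (EuclideanSpace.single α 1) = (R *ᵥ z.ofLp) α := by
  have hH : HasFDerivAt (quadraticHamiltonian R) _ z :=
    (hasFDerivAt_quadForm hR z).const_mul (1 / 2)
  rw [hH.fderiv]
  simp [EuclideanSpace.inner_single_right]

theorem isHamiltonTrajectory_iff_hasDerivAt (hR : R.IsSymm) (z : ℝ → PhaseSpace n) :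
    IsHamiltonTrajectory (quadraticHamiltonian R) z ↔
      ∀ t, HasDerivAt (fun s => (z s).ofLp) ((standardJ n * R) *ᵥ (z t).ofLp) t := by
  refine forall_congr' fun t => ?_
  rw [hasDerivAt_pi, ← Matrix.mulVec_mulVec, standardJ, Matrix.fromBlocks_mulVec]
  simp only [fderiv_quadraticHamiltonian_single hR, Sum.forall, Matrix.zero_mulVec,
    Matrix.one_mulVec, Matrix.neg_mulVec, zero_add, add_zero, Sum.elim_inl, Sum.elim_inr]
  exact forall_and

theorem isHamiltonTrajectory_iff_classicalFlow (hR : R.IsSymm) (z : ℝ → PhaseSpace n) :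
    IsHamiltonTrajectory (quadraticHamiltonian R) z ↔
      ∀ t, z t = Matrix.toEuclideanLin (classicalFlow R t) (z 0) := by
  rw [isHamiltonTrajectory_iff_hasDerivAt hR, forall_hasDerivAt_mulVec_iff]
  refine forall_congr' fun t => ?_
  rw [← (WithLp.ofLp_injective 2).eq_iff]
  rfl

theorem classicalFlow_zero (R : Matrix (Fin n ⊕ Fin n) (Fin n ⊕ Fin n) ℝ) :
    classicalFlow R 0 = 1 := by
  simp [classicalFlow]

theorem hasDerivAt_classicalFlow (R : Matrix (Fin n ⊕ Fin n) (Fin n ⊕ Fin n) ℝ) (t : ℝ) :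
    HasDerivAt (classicalFlow R) (standardJ n * R * classicalFlow R t) t :=
  hasDerivAt_exp_smul (standardJ n * R) t

end Classical

/-! ### The Siegel half-space -/

section ComplexMatrices

open scoped ComplexOrder

variable {ι : Type*} [Fintype ι] [DecidableEq ι]

/-- Extension of scalars of square matrices from `ℝ` to `ℂ`. -/
def toComplex : Matrix ι ι ℝ →+* Matrix ι ι ℂ :=
  Complex.ofRealHom.mapMatrix

@[simp]
theorem toComplex_apply (A : Matrix ι ι ℝ) (i j : ι) : toComplex A i j = (A i j : ℂ) :=
  rfl

theorem toComplex_transpose (A : Matrix ι ι ℝ) : toComplex Aᵀ = (toComplex A)ᵀ :=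
  rfl

theorem conjTranspose_toComplex (A : Matrix ι ι ℝ) : (toComplex A)ᴴ = toComplex Aᵀ := by
  ext i j
  simp

theorem isUnit_det_toComplex {A : Matrix ι ι ℝ} (hA : IsUnit A.det) :
    IsUnit (toComplex A).det := by
  rw [toComplex, ← RingHom.map_det]
  exact hA.map Complex.ofRealHom

theorem posDef_toComplex_iff {X : Matrix ι ι ℝ} : (toComplex X).PosDef ↔ X.PosDef := by
  constructor
  · intro h
    refine Matrix.PosDef.of_dotProduct_mulVec_pos ?_ fun v hv => ?_
    · ext i j
      simpa using congr(($(h.isHermitian) i j).re)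
    · have hpos := h.dotProduct_mulVec_pos (x := Complex.ofReal ∘ v) fun h0 =>
        hv (funext fun i => by simpa using congrFun h0 i)
      have hcast : star (Complex.ofReal ∘ v) ⬝ᵥ toComplex X *ᵥ (Complex.ofReal ∘ v) =
          ((star v ⬝ᵥ X *ᵥ v : ℝ) : ℂ) := by
        simp [dotProduct, Matrix.mulVec]
      rwa [hcast, Complex.zero_lt_real] at hpos
  · intro h
    obtain ⟨P, hP, rfl⟩ := exists_transpose_mul_self h
    rw [map_mul, ← conjTranspose_toComplex]
    exact Matrix.PosDef.conjTranspose_mul_self _ (Matrix.mulVec_injective_iff_isUnit.2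
      ((Matrix.isUnit_iff_isUnit_det _).2 (isUnit_det_toComplex hP)))

/-- The complex matrix `X + iY` that packages the two real parameters of a squeezed Gaussian. -/
def complexCovariance (X Y : Matrix ι ι ℝ) : Matrix ι ι ℂ :=
  toComplex X + Complex.I • toComplex Y

theorem map_re_complexCovariance (X Y : Matrix ι ι ℝ) :
    (complexCovariance X Y).map Complex.re = X := by
  ext i j
  simp [complexCovariance]

theorem map_im_complexCovariance (X Y : Matrix ι ι ℝ) :
    (complexCovariance X Y).map Complex.im = Y := by
  ext i j
  simp [complexCovariance]

theorem complexCovariance_re_im (M : Matrix ι ι ℂ) :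
    complexCovariance (M.map Complex.re) (M.map Complex.im) = M := by
  ext i j
  apply Complex.ext <;> simp [complexCovariance]

theorem complexCovariance_inj {X Y X' Y' : Matrix ι ι ℝ} :
    complexCovariance X Y = complexCovariance X' Y' ↔ X = X' ∧ Y = Y' := by
  refine ⟨fun h => ⟨?_, ?_⟩, fun h => by rw [h.1, h.2]⟩
  · rw [← map_re_complexCovariance X Y, h, map_re_complexCovariance]
  · rw [← map_im_complexCovariance X Y, h, map_im_complexCovariance]

/-- The Siegel half-space in its right half-plane form: complex symmetric matrices with positive
definite real part. -/
def IsSiegel {ι : Type*} (M : Matrix ι ι ℂ) : Prop :=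
  M.IsSymm ∧ (M.map Complex.re).PosDef

theorem isSiegel_complexCovariance {X Y : Matrix ι ι ℝ} (hX : X.PosDef) (hY : Y.IsSymm) :
    IsSiegel (complexCovariance X Y) := by
  refine ⟨?_, by rwa [map_re_complexCovariance]⟩
  simp only [complexCovariance, Matrix.IsSymm, Matrix.transpose_add, Matrix.transpose_smul,
    ← toComplex_transpose, (isSymm_of_posDef hX).eq, hY.eq]

omit [Fintype ι] [DecidableEq ι] in
theorem isSiegel_iff_posDef_add_conjTranspose [Finite ι] {M : Matrix ι ι ℂ} :
    IsSiegel M ↔ M.IsSymm ∧ (M + Mᴴ).PosDef := by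
  classical
  have := Fintype.ofFinite ι
  refine and_congr_right fun hM => ?_
  have htwo : M + Mᴴ = (2 : ℝ) • toComplex (M.map Complex.re) := by
    ext i j
    simp [hM.apply i j, Complex.add_conj]
  rw [htwo, ← posDef_toComplex_iff]
  refine ⟨fun h => h.smul two_pos, fun h => ?_⟩
  simpa [smul_smul] using h.smul (show (0 : ℝ) < 2⁻¹ by norm_num)

end ComplexMatrices

section SiegelHalfSpace

open scoped ComplexOrder

/-- The `2n × n` matrix `(1, iM)`, whose columns span a complex Lagrangian subspace. -/
def lagrangianFrame (M : Matrix (Fin n) (Fin n) ℂ) : Matrix (Fin n ⊕ Fin n) (Fin n) ℂ :=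
  Matrix.fromRows 1 (Complex.I • M)

/-- The upper block of `S (1, iM)`, the automorphy factor of the action of `S` on `M`. -/
def siegelDenominator (S : Matrix (Fin n ⊕ Fin n) (Fin n ⊕ Fin n) ℝ)
    (M : Matrix (Fin n) (Fin n) ℂ) : Matrix (Fin n) (Fin n) ℂ :=
  (toComplex S * lagrangianFrame M).toRows₁

/-- The action of a symplectic matrix on the Siegel half-space, normalized so that `S (1, iM)` and
`(1, i (siegelAction S M))` have the same column space. -/
def siegelAction (S : Matrix (Fin n ⊕ Fin n) (Fin n ⊕ Fin n) ℝ)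
    (M : Matrix (Fin n) (Fin n) ℂ) : Matrix (Fin n) (Fin n) ℂ :=
  -Complex.I • ((toComplex S * lagrangianFrame M).toRows₂ * (siegelDenominator S M)⁻¹)

theorem toComplex_standardJ :
    toComplex (standardJ n) = Matrix.fromBlocks 0 1 (-1) 0 := by
  simp [toComplex, standardJ, Matrix.fromBlocks_map, Matrix.map_neg]

theorem toComplex_standardJ_mul_fromRows {m : Type*} (U V : Matrix (Fin n) m ℂ) :
    toComplex (standardJ n) * Matrix.fromRows U V = Matrix.fromRows V (-U) := by
  simp [toComplex_standardJ, Matrix.fromBlocks_mul_fromRows]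

theorem toComplex_standardJ_mulVec_elim (u v : Fin n → ℂ) :
    toComplex (standardJ n) *ᵥ Sum.elim u v = Sum.elim v (-u) := by
  simp [toComplex_standardJ, Matrix.fromBlocks_mulVec, Matrix.neg_mulVec]

theorem transpose_lagrangianFrame_mul_standardJ_mul (M : Matrix (Fin n) (Fin n) ℂ) :
    (lagrangianFrame M)ᵀ * (toComplex (standardJ n) * lagrangianFrame M) =
      Complex.I • (M - Mᵀ) := by
  rw [lagrangianFrame, toComplex_standardJ_mul_fromRows, Matrix.transpose_fromRows,
    Matrix.fromCols_mul_fromRows]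
  simp [sub_eq_add_neg]

theorem conjTranspose_lagrangianFrame_mul_standardJ_mul (M : Matrix (Fin n) (Fin n) ℂ) :
    (lagrangianFrame M)ᴴ * (toComplex (standardJ n) * lagrangianFrame M) =
      Complex.I • (M + Mᴴ) := by
  rw [lagrangianFrame, toComplex_standardJ_mul_fromRows,
    Matrix.conjTranspose_fromRows_eq_fromCols_conjTranspose, Matrix.fromCols_mul_fromRows]
  simp [smul_add]

variable {S : Matrix (Fin n ⊕ Fin n) (Fin n ⊕ Fin n) ℝ} {M : Matrix (Fin n) (Fin n) ℂ}

theorem toComplex_transpose_mul_standardJ_mul (hS : S ∈ Matrix.symplecticGroup (Fin n) ℝ) :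
    toComplex Sᵀ * (toComplex (standardJ n) * toComplex S) = toComplex (standardJ n) := by
  rw [← map_mul, ← map_mul, ← mul_assoc, transpose_mul_standardJ_mul hS]

theorem transpose_frame_image_mul_standardJ_mul (hS : S ∈ Matrix.symplecticGroup (Fin n) ℝ) :
    (toComplex S * lagrangianFrame M)ᵀ *
      (toComplex (standardJ n) * (toComplex S * lagrangianFrame M)) = Complex.I • (M - Mᵀ) := by
  rw [← transpose_lagrangianFrame_mul_standardJ_mul, Matrix.transpose_mul, ← toComplex_transpose]
  conv_rhs => rw [← toComplex_transpose_mul_standardJ_mul hS]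
  simp only [Matrix.mul_assoc]

theorem conjTranspose_frame_image_mul_standardJ_mul
    (hS : S ∈ Matrix.symplecticGroup (Fin n) ℝ) :
    (toComplex S * lagrangianFrame M)ᴴ *
      (toComplex (standardJ n) * (toComplex S * lagrangianFrame M)) = Complex.I • (M + Mᴴ) := by
  rw [← conjTranspose_lagrangianFrame_mul_standardJ_mul, Matrix.conjTranspose_mul,
    conjTranspose_toComplex]
  conv_rhs => rw [← toComplex_transpose_mul_standardJ_mul hS]
  simp only [Matrix.mul_assoc]

theorem isUnit_siegelDenominator (hS : S ∈ Matrix.symplecticGroup (Fin n) ℝ) (hM : IsSiegel M) :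
    IsUnit (siegelDenominator S M) := by
  rw [← Matrix.mulVec_injective_iff_isUnit, ← Matrix.coe_mulVecLin, ← LinearMap.ker_eq_bot,
    LinearMap.ker_eq_bot']
  intro v hv
  by_contra hv0
  set F := toComplex S * lagrangianFrame M
  have hFv : F *ᵥ v = Sum.elim (0 : Fin n → ℂ) (F.toRows₂ *ᵥ v) := by
    conv_lhs => rw [← Matrix.fromRows_toRows F, Matrix.fromRows_mulVec]
    exact congrArg (fun u => Sum.elim u _) hv
  have hpos := (isSiegel_iff_posDef_add_conjTranspose.1 hM).2.dotProduct_mulVec_pos hv0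
  have hzero : star v ⬝ᵥ ((Complex.I • (M + Mᴴ)) *ᵥ v) = 0 := by
    have hFJF : Complex.I • (M + Mᴴ) = Fᴴ * (toComplex (standardJ n) * F) :=
      (conjTranspose_frame_image_mul_standardJ_mul hS).symm
    rw [hFJF, ← Matrix.mulVec_mulVec, Matrix.dotProduct_mulVec, ← Matrix.star_mulVec,
      ← Matrix.mulVec_mulVec v _ F, hFv]
    simp [toComplex_standardJ_mulVec_elim, dotProduct]
  rw [Matrix.smul_mulVec, dotProduct_smul, smul_eq_mul, mul_eq_zero] at hzero
  exact hpos.ne' (hzero.resolve_left Complex.I_ne_zero)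

theorem toComplex_mul_lagrangianFrame (hS : S ∈ Matrix.symplecticGroup (Fin n) ℝ)
    (hM : IsSiegel M) : toComplex S * lagrangianFrame M =
      lagrangianFrame (siegelAction S M) * siegelDenominator S M := by
  have hP := (Matrix.isUnit_iff_isUnit_det _).1 (isUnit_siegelDenominator hS hM)
  conv_lhs => rw [← Matrix.fromRows_toRows (toComplex S * lagrangianFrame M)]
  rw [lagrangianFrame.eq_1 (siegelAction S M), Matrix.fromRows_mul, one_mul, siegelAction,
    smul_smul, Matrix.smul_mul, Matrix.nonsing_inv_mul_cancel_right _ _ hP]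
  simp [siegelDenominator]

theorem isSiegel_siegelAction (hS : S ∈ Matrix.symplecticGroup (Fin n) ℝ) (hM : IsSiegel M) :
    IsSiegel (siegelAction S M) := by
  have hP := isUnit_siegelDenominator hS hM
  have hframe := toComplex_mul_lagrangianFrame hS hM
  set P := siegelDenominator S M
  set M' := siegelAction S M
  have hsymm : Pᵀ * (Complex.I • (M' - M'ᵀ)) * P = Complex.I • (M - Mᵀ) := by
    rw [← transpose_frame_image_mul_standardJ_mul (M := M) hS, hframe,
      ← transpose_lagrangianFrame_mul_standardJ_mul M', Matrix.transpose_mul]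
    simp only [Matrix.mul_assoc]
  have hherm : Pᴴ * (M' + M'ᴴ) * P = M + Mᴴ := by
    refine smul_right_injective _ Complex.I_ne_zero ?_
    simp only
    rw [← conjTranspose_frame_image_mul_standardJ_mul (M := M) hS, hframe, Matrix.conjTranspose_mul,
      ← Matrix.smul_mul, ← Matrix.mul_smul, ← conjTranspose_lagrangianFrame_mul_standardJ_mul M']
    simp only [Matrix.mul_assoc]
  rw [isSiegel_iff_posDef_add_conjTranspose] at hM ⊢
  constructor
  · rw [hM.1.eq, sub_self, smul_zero, hP.mul_left_eq_zero,
      ((Matrix.isUnit_transpose P).2 hP).mul_right_eq_zero, smul_eq_zero, sub_eq_zero] at hsymm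
    exact (hsymm.resolve_left Complex.I_ne_zero).symm
  · rw [← Matrix.IsUnit.posDef_star_left_conjugate_iff hP, Matrix.star_eq_conjTranspose, hherm]
    exact hM.2

end SiegelHalfSpace

/-! ### Quantum blobs and the Siegel half-space -/

section Blobs

theorem isUnit_det_of_mem_symplecticGroup {S : Matrix (Fin n ⊕ Fin n) (Fin n ⊕ Fin n) ℝ}
    (hS : S ∈ Matrix.symplecticGroup (Fin n) ℝ) : IsUnit S.det :=
  SymplecticGroup.symplectic_det hS

theorem quantumBlob_eq_setOf_quadForm_le {ħ : ℝ} (hħ : 0 ≤ ħ) (z₀ : PhaseSpace n)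
    {S : Matrix (Fin n ⊕ Fin n) (Fin n ⊕ Fin n) ℝ} (hS : IsUnit S.det) :
    quantumBlob ħ z₀ S = {z | quadForm ((S⁻¹)ᵀ * S⁻¹) (z - z₀) ≤ ħ} := by
  ext z
  simp only [quantumBlob, Set.mem_image, Metric.mem_closedBall, dist_zero_right,
    Set.mem_ofPred_eq, exists_exists_and_eq_and, quadForm_transpose_mul_self]
  rw [← Real.le_sqrt (norm_nonneg _) hħ]
  constructor
  · rintro ⟨u, hu, rfl⟩
    simpa [← toEuclideanLin_mul_apply, Matrix.nonsing_inv_mul _ hS] using hu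
  · intro h
    exact ⟨_, h, by simp [← toEuclideanLin_mul_apply, Matrix.mul_nonsing_inv _ hS]⟩

theorem image_quantumBlob (ħ : ℝ) (z₀ : PhaseSpace n)
    (S T : Matrix (Fin n ⊕ Fin n) (Fin n ⊕ Fin n) ℝ) :
    Matrix.toEuclideanLin T '' quantumBlob ħ z₀ S =
      quantumBlob ħ (Matrix.toEuclideanLin T z₀) (T * S) := by
  ext z
  simp only [quantumBlob, Set.mem_image, exists_exists_and_eq_and, map_add,
    toEuclideanLin_mul_apply]

/-- The matrix `G` of the Gaussian Wigner transform of a squeezed coherent state with parameters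
`X` and `Y`. -/
def blobMatrix (X Y : Matrix (Fin n) (Fin n) ℝ) : Matrix (Fin n ⊕ Fin n) (Fin n ⊕ Fin n) ℝ :=
  Matrix.fromBlocks (X + Y * X⁻¹ * Y) (Y * X⁻¹) (X⁻¹ * Y) X⁻¹

@[simp]
theorem blobMatrix_one_zero :
    blobMatrix (1 : Matrix (Fin n) (Fin n) ℝ) 0 = 1 := by
  simp [blobMatrix]

theorem exists_mem_symplecticGroup_blobMatrix_eq {X Y : Matrix (Fin n) (Fin n) ℝ}
    (hX : X.PosDef) (hY : Y.IsSymm) :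
    ∃ S ∈ Matrix.symplecticGroup (Fin n) ℝ, blobMatrix X Y = Sᵀ * S := by
  obtain ⟨P, hP, rfl⟩ := exists_transpose_mul_self hX
  have hPT : Pᵀ * P⁻¹ᵀ = 1 := by
    rw [← Matrix.transpose_mul, Matrix.nonsing_inv_mul _ hP, Matrix.transpose_one]
  refine ⟨Matrix.fromBlocks P 0 (P⁻¹ᵀ * Y) P⁻¹ᵀ, ?_, ?_⟩
  · rw [SymplecticGroup.fromBlocks_mem_iff]
    refine ⟨?_, by simp, by simp [hPT]⟩
    rw [← mul_assoc, hPT, one_mul, Matrix.transpose_mul, Matrix.transpose_transpose, hY.eq,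
      mul_assoc, Matrix.nonsing_inv_mul _ hP, mul_one]
  · rw [Matrix.fromBlocks_transpose, Matrix.fromBlocks_multiply, blobMatrix, Matrix.mul_inv_rev]
    simp [hY.eq, Matrix.transpose_nonsing_inv, mul_assoc]

theorem posDef_blobMatrix {X Y : Matrix (Fin n) (Fin n) ℝ} (hX : X.PosDef) (hY : Y.IsSymm) :
    (blobMatrix X Y).PosDef := by
  obtain ⟨S, hS, hXY⟩ := exists_mem_symplecticGroup_blobMatrix_eq hX hY
  rw [hXY]
  exact posDef_transpose_mul_self (isUnit_det_of_mem_symplecticGroup hS)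

theorem inv_mem_symplecticGroup {S : Matrix (Fin n ⊕ Fin n) (Fin n ⊕ Fin n) ℝ}
    (hS : S ∈ Matrix.symplecticGroup (Fin n) ℝ) : S⁻¹ ∈ Matrix.symplecticGroup (Fin n) ℝ := by
  rw [← SymplecticGroup.coe_inv' ⟨S, hS⟩]
  exact SetLike.coe_mem _

theorem toComplex_add_toComplex_mul_I_smul_complexCovariance
    (A B X Y : Matrix (Fin n) (Fin n) ℝ) :
    toComplex A + toComplex B * (Complex.I • complexCovariance X Y) =
      complexCovariance (A - B * Y) (B * X) := by
  simp only [complexCovariance, map_sub, map_mul, Matrix.mul_smul, Matrix.mul_add, smul_add,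
    smul_smul, Complex.I_mul_I, neg_smul, one_smul, Matrix.mul_neg]
  abel

theorem fromBlocks_mul_lagrangianFrame_complexCovariance_iff
    {A B C D X Y : Matrix (Fin n) (Fin n) ℝ} :
    toComplex (Matrix.fromBlocks A B C D) * lagrangianFrame (complexCovariance X Y) =
        -Complex.I • (toComplex (standardJ n) * lagrangianFrame (complexCovariance X Y)) ↔
      A = X + B * Y ∧ B * X = Y ∧ C = D * Y ∧ D * X = 1 := by
  have hblocks : toComplex (Matrix.fromBlocks A B C D) = Matrix.fromBlocks (toComplex A)
      (toComplex B) (toComplex C) (toComplex D) := Matrix.fromBlocks_map ..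
  have hscalar (U V : Matrix (Fin n) (Fin n) ℂ) : -Complex.I • Matrix.fromRows U V =
      Matrix.fromRows (-Complex.I • U) (-Complex.I • V) := by
    ext (i | i) j <;> rfl
  have hI : -Complex.I • -(1 : Matrix (Fin n) (Fin n) ℂ) = complexCovariance 0 1 := by
    simp [complexCovariance]
  rw [lagrangianFrame, toComplex_standardJ_mul_fromRows, hblocks, Matrix.fromBlocks_mul_fromRows]
  simp only [Matrix.mul_one, toComplex_add_toComplex_mul_I_smul_complexCovariance, hscalar, hI,
    smul_smul, complexCovariance_inj, neg_mul, Complex.I_mul_I, neg_neg, one_smul,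
    Matrix.fromRows_ext_iff, sub_eq_iff_eq_add, zero_add, and_assoc]

theorem mul_lagrangianFrame_complexCovariance_iff
    {G : Matrix (Fin n ⊕ Fin n) (Fin n ⊕ Fin n) ℝ} {X Y : Matrix (Fin n) (Fin n) ℝ}
    (hX : IsUnit X.det) :
    toComplex G * lagrangianFrame (complexCovariance X Y) =
        -Complex.I • (toComplex (standardJ n) * lagrangianFrame (complexCovariance X Y)) ↔
      G = blobMatrix X Y := by
  rw [← Matrix.fromBlocks_toBlocks G, fromBlocks_mul_lagrangianFrame_complexCovariance_iff,
    blobMatrix, Matrix.fromBlocks_inj]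
  constructor
  · rintro ⟨hA, hB, hC, hD⟩
    have hD' : G.toBlocks₂₂ = X⁻¹ := (Matrix.inv_eq_left_inv hD).symm
    have hB' : G.toBlocks₁₂ = Y * X⁻¹ := by
      rw [← hB, Matrix.mul_nonsing_inv_cancel_right _ _ hX]
    exact ⟨by rw [hA, hB'], hB', by rw [hC, hD'], hD'⟩
  · rintro ⟨hA, hB, hC, hD⟩
    exact ⟨by rw [hA, hB], by rw [hB, Matrix.nonsing_inv_mul_cancel_right _ _ hX],
      by rw [hC, hD], by rw [hD, Matrix.nonsing_inv_mul _ hX]⟩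

theorem blobMatrix_siegelAction {S : Matrix (Fin n ⊕ Fin n) (Fin n ⊕ Fin n) ℝ}
    (hS : S ∈ Matrix.symplecticGroup (Fin n) ℝ) {M : Matrix (Fin n) (Fin n) ℂ} (hM : IsSiegel M) :
    blobMatrix ((siegelAction S M).map Complex.re) ((siegelAction S M).map Complex.im) =
      (S⁻¹)ᵀ * blobMatrix (M.map Complex.re) (M.map Complex.im) * S⁻¹ := by
  have hdet := isUnit_det_of_mem_symplecticGroup hS
  have hP := (Matrix.isUnit_iff_isUnit_det _).1 (isUnit_siegelDenominator hS hM)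
  have hframe := toComplex_mul_lagrangianFrame hS hM
  have hG := (mul_lagrangianFrame_complexCovariance_iff (Y := M.map Complex.im)
    hM.2.det_pos.ne'.isUnit).2 rfl
  have hSJ : (S⁻¹)ᵀ * standardJ n = standardJ n * S := by
    conv_rhs => rw [← transpose_mul_standardJ_mul (inv_mem_symplecticGroup hS)]
    rw [Matrix.nonsing_inv_mul_cancel_right _ _ hdet]
  symm
  rw [← mul_lagrangianFrame_complexCovariance_iff
    (isSiegel_siegelAction hS hM).2.det_pos.ne'.isUnit]
  rw [complexCovariance_re_im] at hG ⊢
  set P := siegelDenominator S M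
  set W' := lagrangianFrame (siegelAction S M)
  set G := blobMatrix (M.map Complex.re) (M.map Complex.im)
  suffices h : toComplex ((S⁻¹)ᵀ * G * S⁻¹) * (W' * P) =
      -Complex.I • (toComplex (standardJ n) * (W' * P)) by
    rw [← Matrix.mul_nonsing_inv_cancel_right _ W' hP, ← Matrix.mul_assoc, h, Matrix.smul_mul]
    simp only [Matrix.mul_assoc]
  calc toComplex ((S⁻¹)ᵀ * G * S⁻¹) * (W' * P)
      = toComplex (S⁻¹)ᵀ * (toComplex G * lagrangianFrame M) := by
        rw [← hframe, ← Matrix.mul_assoc, ← map_mul,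
          Matrix.nonsing_inv_mul_cancel_right _ _ hdet, map_mul, Matrix.mul_assoc]
    _ = -Complex.I • (toComplex (standardJ n) * (W' * P)) := by
        rw [hG, Matrix.mul_smul, ← Matrix.mul_assoc, ← map_mul, hSJ, map_mul, Matrix.mul_assoc,
          hframe]

end Blobs

/-! ### The Wigner transform of a coherent state -/

section GaussianIntegrals

theorem inner_eq_dotProduct {ι : Type*} [Fintype ι] (u v : EuclideanSpace ℝ ι) :
    inner ℝ u v = u.ofLp ⬝ᵥ v.ofLp := by
  rw [EuclideanSpace.inner_eq_star_dotProduct, star_trivial, dotProduct_comm]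

variable {ι : Type*} [Fintype ι] [DecidableEq ι]

theorem integral_comp_toEuclideanLin {P : Matrix ι ι ℝ} (hP : IsUnit P.det)
    (f : EuclideanSpace ℝ ι → ℂ) :
    ∫ y, f (Matrix.toEuclideanLin P y) = ((|P.det|⁻¹ : ℝ) : ℂ) * ∫ y, f y := by
  have hdet : LinearMap.det (Matrix.toEuclideanLin P) = P.det := LinearMap.det_toLpLin 2 P
  have hdet0 : LinearMap.det (Matrix.toEuclideanLin P) ≠ 0 := hdet ▸ hP.ne_zero
  have hemb : MeasurableEmbedding (Matrix.toEuclideanLin P) :=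
    ((Matrix.toEuclideanLin P).equivOfDetNeZero hdet0).toContinuousLinearEquiv.toHomeomorph
      |>.measurableEmbedding
  rw [← hemb.integral_map, Measure.map_linearMap_addHaar_eq_smul_addHaar volume hdet0,
    integral_smul_measure, ENNReal.toReal_ofReal (abs_nonneg _), hdet, abs_inv]
  simp

theorem det_transpose_mul_self_rpow_neg_half (P : Matrix ι ι ℝ) :
    (Pᵀ * P).det ^ (-(1 / 2) : ℝ) = |P.det|⁻¹ := by
  rw [Matrix.det_mul, Matrix.det_transpose, ← sq, ← sq_abs, Real.rpow_neg (by positivity),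
    ← Real.sqrt_eq_rpow, Real.sqrt_sq (abs_nonneg _)]

theorem integral_cexp_neg_mul_quadForm_add {X : Matrix ι ι ℝ} (hX : X.PosDef) {b : ℝ}
    (hb : 0 < b) (c : ℂ) (k : EuclideanSpace ℝ ι) :
    ∫ y, Complex.exp (-(b * quadForm X y : ℝ) + c * (inner ℝ k y : ℝ)) =
      (((Real.pi / b) ^ (Fintype.card ι / 2 : ℝ) * X.det ^ (-(1 / 2) : ℝ) : ℝ) : ℂ) *
        Complex.exp (c ^ 2 * (quadForm X⁻¹ k : ℝ) / (4 * b)) := by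
  obtain ⟨P, hP, rfl⟩ := exists_transpose_mul_self hX
  set k' := Matrix.toEuclideanLin P⁻¹ᵀ k with hk'
  have hinner (y) : inner ℝ k y = inner ℝ k' (Matrix.toEuclideanLin P y) := by
    simp only [hk', inner_eq_dotProduct, Matrix.ofLp_toLpLin, Matrix.toLin'_apply]
    rw [Matrix.mulVec_transpose, ← Matrix.dotProduct_mulVec, Matrix.mulVec_mulVec,
      Matrix.nonsing_inv_mul _ hP, Matrix.one_mulVec]
  have hinv : quadForm (Pᵀ * P)⁻¹ k = ‖k'‖ ^ 2 := by
    rw [hk', ← quadForm_transpose_mul_self, Matrix.transpose_transpose, Matrix.mul_inv_rev,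
      Matrix.transpose_nonsing_inv]
  have hpi : (((Real.pi / b) ^ (Fintype.card ι / 2 : ℝ) : ℝ) : ℂ) =
      ((Real.pi : ℂ) / b) ^ (Module.finrank ℝ (EuclideanSpace ℝ ι) / 2 : ℂ) := by
    rw [Complex.ofReal_cpow (by positivity)]
    simp
  have hstandard := GaussianFourier.integral_cexp_neg_mul_sq_norm_add (b := (b : ℂ))
    (by simpa using hb) c k'
  simp_rw [quadForm_transpose_mul_self, hinner]
  rw [integral_comp_toEuclideanLin hP (fun u =>
      Complex.exp (-(b * ‖u‖ ^ 2 : ℝ) + c * (inner ℝ k' u : ℝ))),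
    det_transpose_mul_self_rpow_neg_half, hinv, Complex.ofReal_mul, hpi]
  simp only [Complex.ofReal_mul, Complex.ofReal_pow, ← neg_mul]
  rw [hstandard]
  ring

end GaussianIntegrals

section CoherentStates

/-- The prefactor `(πħ)^{-n/4} (det X)^{1/4}`, which normalizes the squeezed Gaussian in `L²`. -/
def gaussianAmplitude (ħ : ℝ) (X : Matrix (Fin n) (Fin n) ℝ) : ℝ :=
  (Real.pi * ħ) ^ (-(n : ℝ) / 4) * X.det ^ (1 / 4 : ℝ)

theorem gaussianAmplitude_pos {ħ : ℝ} (hħ : 0 < ħ) {X : Matrix (Fin n) (Fin n) ℝ}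
    (hX : 0 < X.det) : 0 < gaussianAmplitude ħ X := by
  rw [gaussianAmplitude]
  positivity

theorem gaussianAmplitude_sq_mul {ħ : ℝ} (hħ : 0 < ħ) {X : Matrix (Fin n) (Fin n) ℝ}
    (hX : 0 < X.det) :
    gaussianAmplitude ħ X ^ 2 * ((Real.pi * ħ) ^ (n / 2 : ℝ) * X.det ^ (-(1 / 2) : ℝ)) = 1 := by
  have hπ : 0 < Real.pi * ħ := by positivity
  have hπħ : ((Real.pi * ħ) ^ (-(n : ℝ) / 4)) ^ 2 * (Real.pi * ħ) ^ (n / 2 : ℝ) = 1 := by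
    rw [← Real.rpow_mul_natCast hπ.le, ← Real.rpow_add hπ]
    convert Real.rpow_zero _ using 2
    push_cast
    ring
  have hdet : (X.det ^ (1 / 4 : ℝ)) ^ 2 * X.det ^ (-(1 / 2) : ℝ) = 1 := by
    rw [← Real.rpow_mul_natCast hX.le, ← Real.rpow_add hX]
    norm_num
  rw [gaussianAmplitude, mul_pow, mul_mul_mul_comm, hπħ, hdet, one_mul]

/-- The wavefunction `e^{iγ/ħ} T̂(z₀) Φ_{X,Y}` of a squeezed coherent state. -/
def coherentState (ħ : ℝ) (X Y : Matrix (Fin n) (Fin n) ℝ) (z₀ : PhaseSpace n) (γ : ℝ)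
    (x : ConfigSpace n) : ℂ :=
  Complex.exp (Complex.I / (ħ : ℂ) * (γ : ℂ)) * heisenbergWeyl ħ z₀ (squeezedGaussian ħ X Y) x

theorem quadForm_add_half_smul {ι : Type*} [Fintype ι] {A : Matrix ι ι ℝ} (hA : A.IsSymm)
    (u y : EuclideanSpace ℝ ι) : quadForm A (u + (1 / 2 : ℝ) • y) =
      quadForm A u + (A *ᵥ u.ofLp) ⬝ᵥ y.ofLp + 1 / 4 * quadForm A y := by
  rw [quadForm_add hA, quadForm_smul, WithLp.ofLp_smul, dotProduct_smul, smul_eq_mul]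
  ring

theorem quadForm_sub_half_smul {ι : Type*} [Fintype ι] {A : Matrix ι ι ℝ} (hA : A.IsSymm)
    (u y : EuclideanSpace ℝ ι) : quadForm A (u - (1 / 2 : ℝ) • y) =
      quadForm A u - (A *ᵥ u.ofLp) ⬝ᵥ y.ofLp + 1 / 4 * quadForm A y := by
  rw [sub_eq_add_neg, ← smul_neg, quadForm_add_half_smul hA, quadForm_neg, WithLp.ofLp_neg,
    dotProduct_neg, ← sub_eq_add_neg]

theorem coherentState_mul_conj (ħ : ℝ) {X Y : Matrix (Fin n) (Fin n) ℝ} (hX : X.IsSymm)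
    (hY : Y.IsSymm) (z₀ : PhaseSpace n) (γ : ℝ) (x y : ConfigSpace n) :
    coherentState ħ X Y z₀ γ (x + (1 / 2 : ℝ) • y) *
        (starRingEnd ℂ) (coherentState ħ X Y z₀ γ (x - (1 / 2 : ℝ) • y)) =
      (gaussianAmplitude ħ X : ℂ) ^ 2 *
      Complex.exp (-(1 / ħ * quadForm X (x - position z₀) : ℝ)) *
      Complex.exp (-(1 / (4 * ħ) * quadForm X y : ℝ) + Complex.I / ħ *
        (inner ℝ (momentum z₀ - Matrix.toEuclideanLin Y (x - position z₀)) y : ℝ)) := by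
  have hcollect (a₁ a₂ a₃ b₁ b₂ b₃ C : ℂ) :
      Complex.exp a₁ * (Complex.exp a₂ * (C * Complex.exp a₃)) *
        (Complex.exp b₁ * (Complex.exp b₂ * (C * Complex.exp b₃))) =
      C ^ 2 * Complex.exp (a₁ + b₁ + a₂ + b₂ + a₃ + b₃) := by
    simp only [Complex.exp_add]
    ring
  simp only [coherentState, heisenbergWeyl, squeezedGaussian, ← gaussianAmplitude.eq_1, map_mul,
    ← Complex.exp_conj, Complex.conj_ofReal, map_div₀, Complex.conj_I, map_neg, map_add, map_ofNat,
    map_one]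
  rw [hcollect, mul_assoc, ← Complex.exp_add, add_sub_right_comm, sub_right_comm,
    quadForm_add_half_smul hX, quadForm_add_half_smul hY, quadForm_sub_half_smul hX,
    quadForm_sub_half_smul hY]
  simp only [inner_sub_left, inner_add_right, inner_sub_right, real_inner_smul_right,
    inner_eq_dotProduct (Matrix.toEuclideanLin Y _), Matrix.ofLp_toLpLin, Matrix.toLin'_apply]
  push_cast
  ring_nf

theorem norm_sq_coherentState (ħ : ℝ) {X Y : Matrix (Fin n) (Fin n) ℝ} (hX : X.IsSymm)
    (hY : Y.IsSymm) (z₀ : PhaseSpace n) (γ : ℝ) (x : ConfigSpace n) :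
    ‖coherentState ħ X Y z₀ γ x‖ ^ 2 =
      gaussianAmplitude ħ X ^ 2 * Real.exp (-(1 / ħ * quadForm X (x - position z₀))) := by
  have hmul := coherentState_mul_conj ħ hX hY z₀ γ x 0
  simp only [smul_zero, add_zero, sub_zero, Complex.mul_conj', inner_zero_right, quadForm,
    WithLp.ofLp_zero, Matrix.mulVec_zero, dotProduct_zero, mul_zero, Complex.ofReal_zero, neg_zero,
    Complex.exp_zero, mul_one] at hmul
  rw [quadForm]
  exact_mod_cast hmul

theorem integral_norm_sq_coherentState {ħ : ℝ} (hħ : 0 < ħ) {X Y : Matrix (Fin n) (Fin n) ℝ}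
    (hX : X.PosDef) (hY : Y.IsSymm) (z₀ : PhaseSpace n) (γ : ℝ) :
    ∫ x, ‖coherentState ħ X Y z₀ γ x‖ ^ 2 = 1 := by
  have hgauss : ∫ x : ConfigSpace n, Real.exp (-(1 / ħ * quadForm X x)) =
      (Real.pi * ħ) ^ (n / 2 : ℝ) * X.det ^ (-(1 / 2) : ℝ) := by
    have h := integral_cexp_neg_mul_quadForm_add hX (one_div_pos.2 hħ) 0 0
    rw [← Complex.ofReal_inj, ← integral_complex_ofReal]
    simpa using h
  simp_rw [norm_sq_coherentState ħ (isSymm_of_posDef hX) hY]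
  rw [integral_const_mul, integral_sub_right_eq_self
    (fun x => Real.exp (-(1 / ħ * quadForm X x))) (position z₀), hgauss,
    gaussianAmplitude_sq_mul hħ hX.det_pos]

end CoherentStates

section Wigner

theorem position_sub (z w : PhaseSpace n) : position (z - w) = position z - position w := rfl

theorem momentum_sub (z w : PhaseSpace n) : momentum (z - w) = momentum z - momentum w := rfl

theorem quadForm_blobMatrix {X Y : Matrix (Fin n) (Fin n) ℝ} (hY : Y.IsSymm)
    (w : PhaseSpace n) :
    quadForm (blobMatrix X Y) w = quadForm X (position w) +
      quadForm X⁻¹ (momentum w + Matrix.toEuclideanLin Y (position w)) := by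
  have hw : w.ofLp = Sum.elim (position w).ofLp (momentum w).ofLp :=
    (Sum.elim_comp_inl_inr w.ofLp).symm
  simp only [quadForm, hw, blobMatrix, Matrix.fromBlocks_mulVec, Sum.elim_comp_inl,
    Sum.elim_comp_inr, sumElim_dotProduct_sumElim, WithLp.ofLp_add, Matrix.ofLp_toLpLin,
    Matrix.toLin'_apply, Matrix.add_mulVec,
    Matrix.mulVec_add, add_dotProduct, dotProduct_add, ← Matrix.mulVec_mulVec,
    dotProduct_mulVec_symm hY]
  ring

theorem gaussianAmplitude_sq_mul_wigner {ħ : ℝ} (hħ : 0 < ħ) {X : Matrix (Fin n) (Fin n) ℝ}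
    (hX : 0 < X.det) :
    (1 / (2 * Real.pi * ħ)) ^ n * (gaussianAmplitude ħ X ^ 2 *
      ((Real.pi / (1 / (4 * ħ))) ^ (n / 2 : ℝ) * X.det ^ (-(1 / 2) : ℝ))) =
      (1 / (Real.pi * ħ)) ^ n := by
  have hfour : (Real.pi / (1 / (4 * ħ))) ^ (n / 2 : ℝ) =
      2 ^ n * (Real.pi * ħ) ^ (n / 2 : ℝ) := by
    have hsq : Real.pi / (1 / (4 * ħ)) = 2 ^ (2 : ℝ) * (Real.pi * ħ) := by
      rw [div_div_eq_mul_div, Real.rpow_two]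
      ring
    rw [hsq, Real.mul_rpow (by positivity) (by positivity), ← Real.rpow_mul two_pos.le,
      mul_div_cancel₀ _ two_ne_zero, Real.rpow_natCast]
  have hprefactor : (1 / (2 * Real.pi * ħ)) ^ n * 2 ^ n = (1 / (Real.pi * ħ)) ^ n := by
    rw [← mul_pow]
    congr 1
    field_simp
  rw [hfour]
  linear_combination (1 / (2 * Real.pi * ħ)) ^ n * 2 ^ n * gaussianAmplitude_sq_mul hħ hX +
    hprefactor

theorem wigner_coherentState {ħ : ℝ} (hħ : 0 < ħ) {X Y : Matrix (Fin n) (Fin n) ℝ}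
    (hX : X.PosDef) (hY : Y.IsSymm) (z₀ : PhaseSpace n) (γ : ℝ) (z : PhaseSpace n) :
    wigner ħ (coherentState ħ X Y z₀ γ) z =
      (((1 / (Real.pi * ħ)) ^ n *
        Real.exp (-(1 / ħ) * quadForm (blobMatrix X Y) (z - z₀)) : ℝ) : ℂ) := by
  set u := position z - position z₀ with hu
  set k := momentum (z - z₀) + Matrix.toEuclideanLin Y u with hk
  have hintegrand (y) :
      Complex.exp (-(Complex.I / (ħ : ℂ)) * ((inner ℝ (momentum z) y : ℝ) : ℂ)) *
        coherentState ħ X Y z₀ γ (position z + (1 / 2 : ℝ) • y) *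
        (starRingEnd ℂ) (coherentState ħ X Y z₀ γ (position z - (1 / 2 : ℝ) • y)) =
      (gaussianAmplitude ħ X : ℂ) ^ 2 * Complex.exp (-(1 / ħ * quadForm X u : ℝ)) *
      Complex.exp (-(1 / (4 * ħ) * quadForm X y : ℝ) + -(Complex.I / ħ) * (inner ℝ k y : ℝ)) := by
    rw [mul_assoc, coherentState_mul_conj ħ (isSymm_of_posDef hX) hY, mul_left_comm,
      ← Complex.exp_add, ← hu, hk, momentum_sub, inner_add_left, inner_sub_left, inner_sub_left]
    push_cast
    ring_nf
  have hexponent : (-(Complex.I / (ħ : ℂ))) ^ 2 * ((quadForm X⁻¹ k : ℝ) : ℂ) /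
      (4 * ((1 / (4 * ħ) : ℝ) : ℂ)) = ((-(1 / ħ) * quadForm X⁻¹ k : ℝ) : ℂ) := by
    have hħ' : (ħ : ℂ) ≠ 0 := by exact_mod_cast hħ.ne'
    push_cast
    rw [neg_sq, div_pow, Complex.I_sq]
    field_simp
  unfold wigner
  simp_rw [hintegrand]
  rw [integral_const_mul, integral_cexp_neg_mul_quadForm_add hX (by positivity), hexponent,
    quadForm_blobMatrix hY, position_sub, ← hu, ← hk,
    ← gaussianAmplitude_sq_mul_wigner hħ hX.det_pos, mul_add, Real.exp_add, Fintype.card_fin]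
  push_cast
  ring_nf

theorem wigner_congr {ħ : ℝ} {f g : ConfigSpace n → ℂ} (h : f =ᵐ[volume] g) (z : PhaseSpace n) :
    wigner ħ f z = wigner ħ g z := by
  have hcomp {c : ℝ} (hc : c ≠ 0) :
      ∀ᵐ y : ConfigSpace n, f (position z + c • y) = g (position z + c • y) := by
    have hscale : Measure.QuasiMeasurePreserving (fun y : ConfigSpace n => c • y) volume volume :=
      ⟨measurable_const_smul _, by
        rw [Measure.map_addHaar_smul volume hc]
        exact Measure.smul_absolutelyContinuous⟩
    exact hscale.ae_eq_comp
      ((measurePreserving_add_left volume (position z)).quasiMeasurePreserving.ae_eq_comp h)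
  unfold wigner
  congr 1
  refine integral_congr_ae ?_
  filter_upwards [hcomp (c := 1 / 2) (by norm_num), hcomp (c := -(1 / 2)) (by norm_num)]
    with y hplus hminus
  rw [sub_eq_add_neg, ← neg_smul, hplus, hminus]

theorem correspondsTo_iff_of_wigner {ħ : ℝ} (hħ : 0 < ħ) {ψ : StateSpace n}
    {G : Matrix (Fin n ⊕ Fin n) (Fin n ⊕ Fin n) ℝ} {z₀ : PhaseSpace n} (hG : G.PosDef)
    (hW : ∀ z : PhaseSpace n, wigner ħ ψ z =
      (((1 / (Real.pi * ħ)) ^ n * Real.exp (-(1 / ħ) * quadForm G (z - z₀)) : ℝ) : ℂ))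
    {Q : Set (PhaseSpace n)} :
    CorrespondsTo ħ ψ Q ↔ Q = {z | quadForm G (z - z₀) ≤ ħ} := by
  refine ⟨?_, fun h => ⟨G, z₀, hG, hW, h⟩⟩
  rintro ⟨G', z₁, -, hW', rfl⟩
  ext z
  have hexp := Complex.ofReal_inj.1 ((hW z).symm.trans (hW' z))
  have hform : quadForm G (z - z₀) = quadForm G' (z - z₁) :=
    mul_left_cancel₀ (by simpa using hħ.ne')
      (Real.exp_injective (mul_left_cancel₀ (by positivity) hexp))
  simp only [Set.mem_ofPred_eq, hform]

theorem correspondsTo_iff_of_ae_eq_coherentState {ħ : ℝ} (hħ : 0 < ħ) {ψ : StateSpace n}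
    {X Y : Matrix (Fin n) (Fin n) ℝ} (hX : X.PosDef) (hY : Y.IsSymm) {z₀ : PhaseSpace n} {γ : ℝ}
    (hψ : ψ =ᵐ[volume] coherentState ħ X Y z₀ γ) {Q : Set (PhaseSpace n)} :
    CorrespondsTo ħ ψ Q ↔ Q = {z | quadForm (blobMatrix X Y) (z - z₀) ≤ ħ} :=
  correspondsTo_iff_of_wigner hħ (posDef_blobMatrix hX hY)
    fun z => (wigner_congr hψ z).trans (wigner_coherentState hħ hX hY z₀ γ z)

end Wigner

/-! ### Exponentials with Gaussian decay -/

section GaussianDecay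

open scoped ContDiff Nat

theorem exists_one_add_pow_mul_exp_le (m : ℕ) {c : ℝ} (hc : 0 < c) :
    ∃ K : ℝ, ∀ r : ℝ, 0 ≤ r → (1 + r) ^ m * Real.exp (-(c * r ^ 2)) ≤ K := by
  refine ⟨m ! / c ^ m * Real.exp (2 * c), fun r hr => ?_⟩
  have hpow : (1 + r) ^ m ≤ m ! / c ^ m * Real.exp (c * (1 + r)) := by
    have h := Real.pow_div_factorial_le_exp (c * (1 + r)) (by positivity) m
    rw [div_le_iff₀ (by positivity), mul_pow] at h
    rw [div_mul_eq_mul_div, le_div_iff₀ (by positivity)]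
    linarith
  calc (1 + r) ^ m * Real.exp (-(c * r ^ 2))
      ≤ m ! / c ^ m * Real.exp (c * (1 + r)) * Real.exp (-(c * r ^ 2)) := by gcongr
    _ = m ! / c ^ m * Real.exp (c * (1 + r) - c * r ^ 2) := by
        rw [mul_assoc, ← Real.exp_add, sub_eq_add_neg]
    _ ≤ m ! / c ^ m * Real.exp (2 * c) := by
        gcongr
        nlinarith [sq_nonneg (2 * r - 1)]

theorem norm_iteratedFDeriv_cexp (i : ℕ) (w : ℂ) :
    ‖iteratedFDeriv ℝ i Complex.exp w‖ = ‖Complex.exp w‖ := by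
  have hexp : ContDiffAt ℂ i Complex.exp w := Complex.contDiff_exp.contDiffAt
  rw [← hexp.restrictScalars_iteratedFDeriv (𝕜 := ℝ)]
  simp only [Function.comp_apply, ContinuousMultilinearMap.norm_restrictScalars,
    norm_iteratedFDeriv_eq_norm_iteratedDeriv, iteratedDeriv_eq_iterate, Complex.iter_deriv_exp]

variable {V : Type*} [NormedAddCommGroup V] [NormedSpace ℝ V]

/-- The function `E` has temperate growth and its real part is at most `C - c ‖x‖ ^ 2` with
`0 < c`, so that `exp ∘ E` is a Schwartz function. -/
def HasGaussianDecay (E : V → ℂ) : Prop :=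
  E.HasTemperateGrowth ∧ ∃ C c : ℝ, 0 < c ∧ ∀ x, (E x).re ≤ C - c * ‖x‖ ^ 2

theorem HasGaussianDecay.exists_norm_pow_mul_iteratedFDeriv_cexp_le {E : V → ℂ}
    (hE : HasGaussianDecay E) (k m : ℕ) :
    ∃ K : ℝ, ∀ x, ‖x‖ ^ k * ‖iteratedFDeriv ℝ m (Complex.exp ∘ E) x‖ ≤ K := by
  obtain ⟨htemp, C, c, hc, hre⟩ := hE
  obtain ⟨l, D, hD0, hD⟩ := htemp.norm_iteratedFDeriv_le_uniform m
  obtain ⟨K, hK⟩ := exists_one_add_pow_mul_exp_le (k + l * m) hc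
  refine ⟨m ! * (1 + D) ^ m * Real.exp C * K, fun x => ?_⟩
  have hone : 1 ≤ (1 + D) * (1 + ‖x‖) ^ l :=
    one_le_mul_of_one_le_of_one_le (by linarith) (one_le_pow₀ (by linarith [norm_nonneg x]))
  have hcomp : ‖iteratedFDeriv ℝ m (Complex.exp ∘ E) x‖ ≤
      m ! * Real.exp (C - c * ‖x‖ ^ 2) * ((1 + D) * (1 + ‖x‖) ^ l) ^ m := by
    refine norm_iteratedFDeriv_comp_le (N := ∞) (Complex.contDiff_exp (𝕜 := ℝ)) htemp.1
      (by exact_mod_cast le_top) x (fun i _ => ?_) fun i hi hm => ?_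
    · rw [norm_iteratedFDeriv_cexp, Complex.norm_exp]
      exact Real.exp_le_exp.2 (hre x)
    · calc _ ≤ D * (1 + ‖x‖) ^ l := hD i hm x
        _ ≤ (1 + D) * (1 + ‖x‖) ^ l := by gcongr; linarith
        _ ≤ _ := le_self_pow₀ hone (by omega)
  calc ‖x‖ ^ k * ‖iteratedFDeriv ℝ m (Complex.exp ∘ E) x‖
      ≤ (1 + ‖x‖) ^ k *
          (m ! * Real.exp (C - c * ‖x‖ ^ 2) * ((1 + D) * (1 + ‖x‖) ^ l) ^ m) := by
        gcongr
        linarith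
    _ = m ! * (1 + D) ^ m * Real.exp C *
          ((1 + ‖x‖) ^ (k + l * m) * Real.exp (-(c * ‖x‖ ^ 2))) := by
        rw [sub_eq_add_neg, Real.exp_add, mul_pow, pow_add, pow_mul]
        ring
    _ ≤ m ! * (1 + D) ^ m * Real.exp C * K := by
        gcongr
        exact hK _ (norm_nonneg x)

/-- The Schwartz function `exp ∘ E`, for an exponent `E` with Gaussian decay. -/
def HasGaussianDecay.expSchwartz {E : V → ℂ} (hE : HasGaussianDecay E) : 𝓢(V, ℂ) where
  toFun := Complex.exp ∘ E
  smooth' := (Complex.contDiff_exp (𝕜 := ℝ)).comp hE.1.1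
  decay' := hE.exists_norm_pow_mul_iteratedFDeriv_cexp_le

theorem HasGaussianDecay.expSchwartz_apply {E : V → ℂ} (hE : HasGaussianDecay E) (x : V) :
    hE.expSchwartz x = Complex.exp (E x) := rfl

theorem HasGaussianDecay.exists_memLp_exp_add {F : Type*} [NormedAddCommGroup F]
    [InnerProductSpace ℝ F] [MeasurableSpace F] [BorelSpace F]
    {E : F → ℂ} (hE : HasGaussianDecay E) {C₁ : ℝ} (hC₁ : 0 < C₁) {p : ENNReal}
    {μ : Measure F} [μ.HasTemperateGrowth] :
    ∃ δ > 0, MemLp (fun x => Real.exp (δ * (C₁ * (1 + ‖x‖ ^ 2)) + (E x).re)) p μ := by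
  obtain ⟨htemp, C, c, hc, hre⟩ := hE
  have hquad : HasGaussianDecay fun x : F => ((c / 2 + C - c / 2 * ‖x‖ ^ 2 : ℝ) : ℂ) :=
    ⟨Complex.ofRealCLM.hasTemperateGrowth.comp ((Function.HasTemperateGrowth.const _).sub
      ((Function.HasTemperateGrowth.const _).mul (Function.hasTemperateGrowth_norm_sq F))),
      c / 2 + C, c / 2, half_pos hc, fun x => le_rfl⟩
  refine ⟨c / (2 * C₁), by positivity, (hquad.expSchwartz.memLp p μ).mono ?_ ?_⟩
  · have := htemp.1.continuous
    exact (by fun_prop : Continuous fun x =>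
      Real.exp (c / (2 * C₁) * (C₁ * (1 + ‖x‖ ^ 2)) + (E x).re)).aestronglyMeasurable
  · refine Filter.Eventually.of_forall fun x => ?_
    rw [hquad.expSchwartz_apply, Complex.norm_exp, Real.norm_of_nonneg (Real.exp_nonneg _),
      Complex.ofReal_re, Real.exp_le_exp]
    have hcancel : c / (2 * C₁) * (C₁ * (1 + ‖x‖ ^ 2)) = c / 2 * (1 + ‖x‖ ^ 2) := by field_simp
    linarith [hre x]

end GaussianDecay

section ExponentialFamilies

variable {α K : Type*} [NormedAddCommGroup K] [NormedSpace ℝ K] {E : K →ₗ[ℝ] α → ℂ}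
  {w : α → ℝ}

theorem norm_cexp_sub_one_sub_le (h : ℂ) :
    ‖Complex.exp h - 1 - h‖ ≤ ‖h‖ ^ 2 * Real.exp ‖h‖ := by
  simpa [Finset.sum_range_succ, sub_sub] using Complex.norm_exp_sub_sum_le_norm_mul_exp h 2

theorem norm_cexp_family_remainder_le (hw : ∀ x, 0 ≤ w x) (hE : ∀ k x, ‖E k x‖ ≤ ‖k‖ * w x)
    {δ : ℝ} (hδ : 0 < δ) {k₀ Δ v : K} (hΔ : ‖Δ‖ ≤ δ / 2) (x : α) :
    ‖Complex.exp (E (k₀ + Δ) x) - Complex.exp (E k₀ x) - E v x * Complex.exp (E k₀ x)‖ ≤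
      (8 / δ ^ 2 * ‖Δ‖ ^ 2 + 1 / δ * ‖Δ - v‖) * Real.exp (δ * w x + (E k₀ x).re) := by
  have hsplit : Complex.exp (E (k₀ + Δ) x) - Complex.exp (E k₀ x) - E v x * Complex.exp (E k₀ x) =
      (Complex.exp (E Δ x) - 1 - E Δ x + E (Δ - v) x) * Complex.exp (E k₀ x) := by
    rw [map_add, map_sub, Pi.add_apply, Pi.sub_apply, Complex.exp_add]
    ring
  have hquadratic : ‖Complex.exp (E Δ x) - 1 - E Δ x‖ ≤
      8 / δ ^ 2 * ‖Δ‖ ^ 2 * Real.exp (δ * w x) := by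
    have hsq : w x ^ 2 ≤ 8 / δ ^ 2 * Real.exp (δ / 2 * w x) := by
      have h := Real.pow_div_factorial_le_exp (δ / 2 * w x) (by have := hw x; positivity) 2
      rw [div_mul_eq_mul_div, le_div_iff₀ (by positivity)]
      norm_num at h
      linarith
    calc _ ≤ ‖E Δ x‖ ^ 2 * Real.exp ‖E Δ x‖ := norm_cexp_sub_one_sub_le _
      _ ≤ (‖Δ‖ * w x) ^ 2 * Real.exp (δ / 2 * w x) := by
        gcongr
        · exact hE Δ x
        · exact (hE Δ x).trans (mul_le_mul_of_nonneg_right hΔ (hw x))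
      _ ≤ ‖Δ‖ ^ 2 * (8 / δ ^ 2 * Real.exp (δ / 2 * w x)) * Real.exp (δ / 2 * w x) := by
        rw [mul_pow]
        gcongr
      _ = 8 / δ ^ 2 * ‖Δ‖ ^ 2 * Real.exp (δ * w x) := by
        rw [show δ * w x = δ / 2 * w x + δ / 2 * w x by ring, Real.exp_add]
        ring
  have hlinear : ‖E (Δ - v) x‖ ≤ 1 / δ * ‖Δ - v‖ * Real.exp (δ * w x) := by
    have h : δ * w x ≤ Real.exp (δ * w x) := by linarith [Real.add_one_le_exp (δ * w x)]
    calc _ ≤ ‖Δ - v‖ * w x := hE _ x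
      _ = 1 / δ * ‖Δ - v‖ * (δ * w x) := by field_simp
      _ ≤ _ := by gcongr
  rw [hsplit, norm_mul, Complex.norm_exp, Real.exp_add, ← mul_assoc, add_mul]
  gcongr
  exact (norm_add_le _ _).trans (add_le_add hquadratic hlinear)

variable [MeasurableSpace α] {μ : Measure α} {p : ENNReal} [Fact (1 ≤ p)]

theorem hasDerivAt_Lp_cexp (hw : ∀ x, 0 ≤ w x) (hE : ∀ k x, ‖E k x‖ ≤ ‖k‖ * w x)
    {k : ℝ → K} {k' : K} {t : ℝ} (hk : HasDerivAt k k' t) {δ : ℝ} (hδ : 0 < δ)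
    (hmem : MemLp (fun x => Real.exp (δ * w x + (E (k t) x).re)) p μ) {F : ℝ → Lp ℂ p μ}
    {F' : Lp ℂ p μ} (hF : ∀ s, F s =ᵐ[μ] fun x => Complex.exp (E (k s) x))
    (hF' : F' =ᵐ[μ] fun x => E k' x * Complex.exp (E (k t) x)) : HasDerivAt F F' t := by
  set bound := fun s => 8 / δ ^ 2 * ‖k s - k t‖ ^ 2 + 1 / δ * ‖k s - k t - (s - t) • k'‖
  have hbound : bound =o[nhds t] fun s => s - t := by
    have hid : Filter.Tendsto (fun s => s - t) (nhds t) (nhds 0) := by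
      simpa using (continuous_sub_right t).tendsto t
    have hsq : (fun s => ‖k s - k t‖ ^ 2) =o[nhds t] fun s => s - t := by
      have h := hk.isBigO_sub.norm_left.pow 2
      exact h.trans_isLittleO (by simpa [Function.comp_def] using
        (Asymptotics.isLittleO_pow_id one_lt_two (𝕜 := ℝ)).comp_tendsto hid)
    exact (hsq.const_mul_left _).add (hk.isLittleO.norm_left.const_mul_left _)
  have hnear : ∀ᶠ s in nhds t, ‖k s - k t‖ ≤ δ / 2 := by
    filter_upwards [hk.continuousAt (Metric.closedBall_mem_nhds _ (half_pos hδ))] with s hs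
    simpa [dist_eq_norm] using hs
  refine HasDerivAt.of_isLittleO (Asymptotics.IsBigO.trans_isLittleO
    (Asymptotics.IsBigO.of_bound ‖hmem.toLp‖ ?_) hbound)
  filter_upwards [hnear] with s hs
  rw [mul_comm, Real.norm_of_nonneg (by positivity)]
  refine Lp.norm_le_mul_norm_of_ae_le_mul ?_
  filter_upwards [Lp.coeFn_sub (F s - F t) ((s - t) • F'), Lp.coeFn_sub (F s) (F t),
    Lp.coeFn_smul (s - t) F', hF s, hF t, hF', hmem.coeFn_toLp] with x hx₁ hx₂ hx₃ hs' ht' h' hg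
  have hrem := norm_cexp_family_remainder_le hw hE hδ (k₀ := k t) (v := (s - t) • k') hs x
  rw [add_sub_cancel, map_smul, Pi.smul_apply, smul_mul_assoc] at hrem
  rw [hx₁, Pi.sub_apply, hx₂, hx₃, Pi.sub_apply, Pi.smul_apply, hs', ht', h', hg,
    Real.norm_of_nonneg (Real.exp_nonneg _)]
  exact hrem

end ExponentialFamilies

/-! ### Weyl operators on Gaussian waves -/

section GaussianWaves

/-- Extension of scalars of vectors from `ℝ` to `ℂ`. -/
def toComplexVec {ι : Type*} (v : ι → ℝ) : ι → ℂ := fun i => v i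

theorem toComplex_mulVec_toComplexVec {ι : Type*} [Fintype ι] [DecidableEq ι] (A : Matrix ι ι ℝ)
    (v : ι → ℝ) : toComplex A *ᵥ toComplexVec v = toComplexVec (A *ᵥ v) := by
  ext i
  simp [toComplexVec, Matrix.mulVec, dotProduct, toComplex_apply]

/-- The exponent `a + b · x - (1/2ħ) M x · x` of a Gaussian wave, as a linear function of its
coefficients `(a, b, M)`. -/
def gaussianExponent (ħ : ℝ) :
    ℂ × (Fin n → ℂ) × Matrix (Fin n) (Fin n) ℂ →ₗ[ℝ] ConfigSpace n → ℂ where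
  toFun κ x := κ.1 + κ.2.1 ⬝ᵥ toComplexVec x.ofLp -
    1 / (2 * ħ) * ((κ.2.2 *ᵥ toComplexVec x.ofLp) ⬝ᵥ toComplexVec x.ofLp)
  map_add' κ κ' := by
    funext x
    simp only [Prod.fst_add, Prod.snd_add, add_dotProduct, Matrix.add_mulVec, Pi.add_apply]
    ring
  map_smul' c κ := by
    funext x
    simp only [Prod.smul_fst, Prod.smul_snd, smul_dotProduct, Matrix.smul_mulVec, Pi.smul_apply,
      Complex.real_smul, RingHom.id_apply]
    ring

theorem gaussianExponent_apply (ħ : ℝ) (a : ℂ) (b : Fin n → ℂ) (M : Matrix (Fin n) (Fin n) ℂ)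
    (x : ConfigSpace n) : gaussianExponent ħ (a, b, M) x = a + b ⬝ᵥ toComplexVec x.ofLp -
      1 / (2 * ħ) * ((M *ᵥ toComplexVec x.ofLp) ⬝ᵥ toComplexVec x.ofLp) :=
  rfl

theorem hasTemperateGrowth_gaussianExponent (ħ : ℝ) (a : ℂ) (b : Fin n → ℂ)
    (M : Matrix (Fin n) (Fin n) ℂ) : (gaussianExponent ħ (a, b, M)).HasTemperateGrowth := by
  have hcoord (j : Fin n) : (fun x : ConfigSpace n => ((x j : ℝ) : ℂ)).HasTemperateGrowth :=
    (Complex.ofRealCLM.comp (EuclideanSpace.proj (𝕜 := ℝ) j)).hasTemperateGrowth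
  have hmulVec (i : Fin n) :
      (fun x : ConfigSpace n => (M *ᵥ toComplexVec x.ofLp) i).HasTemperateGrowth := by
    simp only [Matrix.mulVec, dotProduct, toComplexVec]
    exact .sum fun j _ => (Function.HasTemperateGrowth.const (M i j)).mul (hcoord j)
  exact ((Function.HasTemperateGrowth.const a).add
    (.sum fun j _ => (Function.HasTemperateGrowth.const (b j)).mul (hcoord j))).sub
    ((Function.HasTemperateGrowth.const _).mul (.sum fun i _ => (hmulVec i).mul (hcoord i)))

theorem re_gaussianExponent (ħ : ℝ) (a : ℂ) (b : Fin n → ℂ) (M : Matrix (Fin n) (Fin n) ℂ)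
    (x : ConfigSpace n) : (gaussianExponent ħ (a, b, M) x).re =
      a.re + inner ℝ (WithLp.toLp 2 fun j => (b j).re) x -
        1 / (2 * ħ) * quadForm (M.map Complex.re) x := by
  have hħ : (1 / (2 * (ħ : ℂ))) = ((1 / (2 * ħ) : ℝ) : ℂ) := by push_cast; rfl
  rw [gaussianExponent_apply, hħ, Complex.sub_re, Complex.add_re, Complex.re_ofReal_mul,
    inner_eq_dotProduct]
  simp [dotProduct, quadForm, Matrix.mulVec, toComplexVec]

theorem hasGaussianDecay_gaussianExponent {ħ : ℝ} (hħ : 0 < ħ) (a : ℂ) (b : Fin n → ℂ)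
    {M : Matrix (Fin n) (Fin n) ℂ} (hM : IsSiegel M) :
    HasGaussianDecay (gaussianExponent ħ (a, b, M)) := by
  obtain ⟨c, hc, hquad⟩ := exists_mul_norm_sq_le_quadForm hM.2
  set u : ConfigSpace n := WithLp.toLp 2 fun j => (b j).re
  have hc' : 0 < c / (4 * ħ) := by positivity
  refine ⟨hasTemperateGrowth_gaussianExponent ħ a b M, a.re + ‖u‖ ^ 2 / (4 * (c / (4 * ħ))),
    c / (4 * ħ), hc', fun x => ?_⟩
  have hform : 2 * (c / (4 * ħ)) * ‖x‖ ^ 2 ≤ 1 / (2 * ħ) * quadForm (M.map Complex.re) x := by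
    calc _ = 1 / (2 * ħ) * (c * ‖x‖ ^ 2) := by field_simp; ring
      _ ≤ _ := by gcongr; exact hquad x
  have hlinear : inner ℝ u x ≤ ‖u‖ ^ 2 / (4 * (c / (4 * ħ))) + c / (4 * ħ) * ‖x‖ ^ 2 := by
    refine (real_inner_le_norm u x).trans ?_
    rw [div_add' _ _ _ (by positivity), le_div_iff₀ (by positivity)]
    linarith [sq_nonneg (‖u‖ - 2 * (c / (4 * ħ)) * ‖x‖)]
  rw [re_gaussianExponent]
  linarith

/-- The Gaussian wave `exp (a + b · x - (1/2ħ) M x · x)` as a Schwartz function. -/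
def gaussianWave {ħ : ℝ} (hħ : 0 < ħ) (a : ℂ) (b : Fin n → ℂ) {M : Matrix (Fin n) (Fin n) ℂ}
    (hM : IsSiegel M) : 𝓢(ConfigSpace n, ℂ) :=
  (hasGaussianDecay_gaussianExponent hħ a b hM).expSchwartz

theorem gaussianWave_apply {ħ : ℝ} (hħ : 0 < ħ) (a : ℂ) (b : Fin n → ℂ)
    {M : Matrix (Fin n) (Fin n) ℂ} (hM : IsSiegel M) (x : ConfigSpace n) :
    gaussianWave hħ a b hM x = Complex.exp (gaussianExponent ħ (a, b, M) x) := rfl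

end GaussianWaves

section WeylAction

/-- The phase-space point `(x, -iħ ∇E(x))`, where `E = gaussianExponent ħ (a, b, M)`: the quantized
coordinates multiply the Gaussian wave by the coordinates of this point. -/
def gaussianSymbol (ħ : ℝ) (b : Fin n → ℂ) (M : Matrix (Fin n) (Fin n) ℂ) (x : ConfigSpace n) :
    Fin n ⊕ Fin n → ℂ :=
  lagrangianFrame M *ᵥ toComplexVec x.ofLp + Sum.elim (0 : Fin n → ℂ) (-(Complex.I * ħ) • b)

theorem gaussianSymbol_inl (ħ : ℝ) (b : Fin n → ℂ) (M : Matrix (Fin n) (Fin n) ℂ)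
    (x : ConfigSpace n) (j : Fin n) : gaussianSymbol ħ b M x (Sum.inl j) = x j := by
  simp [gaussianSymbol, lagrangianFrame, Matrix.fromRows_mulVec, toComplexVec]

theorem gaussianSymbol_inr (ħ : ℝ) (b : Fin n → ℂ) (M : Matrix (Fin n) (Fin n) ℂ)
    (x : ConfigSpace n) (j : Fin n) : gaussianSymbol ħ b M x (Sum.inr j) =
      Complex.I * (M *ᵥ toComplexVec x.ofLp) j - Complex.I * ħ * b j := by
  simp [gaussianSymbol, lagrangianFrame, Matrix.fromRows_mulVec, Matrix.smul_mulVec,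
    sub_eq_add_neg]

theorem hasDerivAt_toComplexVec_line (x : ConfigSpace n) (j : Fin n) :
    HasDerivAt (fun t : ℝ => toComplexVec (x + t • EuclideanSpace.single j (1 : ℝ)).ofLp)
      (Pi.single j 1) 0 := by
  refine hasDerivAt_pi.2 fun k => ?_
  have hline : HasDerivAt (fun t : ℝ => x k + t * (Pi.single j 1 : Fin n → ℝ) k)
      ((Pi.single j 1 : Fin n → ℝ) k) 0 := by
    simpa using ((hasDerivAt_id (0 : ℝ)).mul_const _).const_add (x k)
  have hcast := hline.ofReal_comp
  simp only [Pi.single_apply] at hcast ⊢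
  simpa [toComplexVec, Pi.single_apply, apply_ite] using hcast

theorem hasLineDerivAt_gaussianSymbol (ħ : ℝ) (b : Fin n → ℂ) (M : Matrix (Fin n) (Fin n) ℂ)
    (x : ConfigSpace n) (j : Fin n) (α : Fin n ⊕ Fin n) :
    HasLineDerivAt ℝ (fun y => gaussianSymbol ħ b M y α) (lagrangianFrame M α j) x
      (EuclideanSpace.single j 1) := by
  have h := (hasDerivAt_mulVec (hasDerivAt_matrix_const (lagrangianFrame M) (0 : ℝ))
    (hasDerivAt_toComplexVec_line x j)).add_const (Sum.elim (0 : Fin n → ℂ) (-(Complex.I * ħ) • b))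
  simpa [HasLineDerivAt, gaussianSymbol] using hasDerivAt_pi.1 h α

variable {ħ : ℝ} {M : Matrix (Fin n) (Fin n) ℂ}

theorem hasLineDerivAt_gaussianExponent (hħ : ħ ≠ 0) (a : ℂ) (b : Fin n → ℂ) (hM : M.IsSymm)
    (x : ConfigSpace n) (j : Fin n) :
    HasLineDerivAt ℝ (gaussianExponent ħ (a, b, M))
      (Complex.I / ħ * gaussianSymbol ħ b M x (Sum.inr j)) x
      (EuclideanSpace.single j 1) := by
  have hħ' : (ħ : ℂ) ≠ 0 := by exact_mod_cast hħ
  have hx := hasDerivAt_toComplexVec_line x j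
  have h := ((hasDerivAt_dotProduct (hasDerivAt_const (0 : ℝ) b) hx).const_add a).sub
    ((hasDerivAt_dotProduct (hasDerivAt_mulVec (hasDerivAt_matrix_const M (0 : ℝ)) hx) hx).const_mul
      (1 / (2 * (ħ : ℂ))))
  refine h.congr_deriv ?_
  rw [gaussianSymbol_inr, Matrix.zero_mulVec, zero_add, zero_dotProduct, zero_add,
    dotProduct_mulVec_symm hM, single_one_dotProduct, dotProduct_single_one,
    dotProduct_single_one, zero_smul, add_zero]
  field_simp
  linear_combination 2 * (ħ * b j - (M *ᵥ toComplexVec x.ofLp) j) * Complex.I_sq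

variable (hħ : 0 < ħ) (a : ℂ) (b : Fin n → ℂ) (hM : IsSiegel M)

theorem quantizedCoord_inr_mul_gaussianWave {φ : 𝓢(ConfigSpace n, ℂ)} {f : ConfigSpace n → ℂ}
    (hφ : ∀ x, φ x = f x * gaussianWave hħ a b hM x) {f' : ℂ} {x : ConfigSpace n} {j : Fin n}
    (hf : HasLineDerivAt ℝ f f' x (EuclideanSpace.single j 1)) :
    quantizedCoord ħ (Sum.inr j) φ x =
      (-(Complex.I * ħ) * f' + gaussianSymbol ħ b M x (Sum.inr j) * f x) *
        gaussianWave hħ a b hM x := by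
  have hħ' : (ħ : ℂ) ≠ 0 := by exact_mod_cast hħ.ne'
  have hprod := HasDerivAt.mul hf (hasLineDerivAt_gaussianExponent hħ.ne' a b hM.1 x j).cexp
  have hφ' : (φ : ConfigSpace n → ℂ) =
      fun y => f y * Complex.exp (gaussianExponent ħ (a, b, M) y) := funext hφ
  have hderiv := HasLineDerivAt.lineDeriv (𝕜 := ℝ) (f := φ) (x := x)
    (v := EuclideanSpace.single j 1) (by rw [hφ']; exact hprod)
  rw [quantizedCoord_inr_apply, hderiv, zero_smul, add_zero, gaussianWave_apply]
  field_simp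
  linear_combination -gaussianSymbol ħ b M x (Sum.inr j) * f x * Complex.I_sq

theorem quantizedCoord_gaussianWave (α : Fin n ⊕ Fin n) (x : ConfigSpace n) :
    quantizedCoord ħ α (gaussianWave hħ a b hM) x =
      gaussianSymbol ħ b M x α * gaussianWave hħ a b hM x := by
  rcases α with j | j
  · rw [quantizedCoord_inl_apply, gaussianSymbol_inl]
  · rw [quantizedCoord_inr_mul_gaussianWave hħ a b hM (f := fun _ => 1)
      (fun x => (one_mul _).symm) (hasDerivAt_const (0 : ℝ) (1 : ℂ)), mul_zero, zero_add, mul_one]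

theorem quantizedCoord_quantizedCoord_gaussianWave (α β : Fin n ⊕ Fin n) (x : ConfigSpace n) :
    quantizedCoord ħ α (quantizedCoord ħ β (gaussianWave hħ a b hM)) x =
      (Sum.elim (0 : Fin n → ℂ) (fun j => -(Complex.I * ħ) * lagrangianFrame M β j) α +
        gaussianSymbol ħ b M x α * gaussianSymbol ħ b M x β) * gaussianWave hħ a b hM x := by
  rcases α with j | j
  · rw [quantizedCoord_inl_apply, quantizedCoord_gaussianWave, gaussianSymbol_inl, Sum.elim_inl,
      Pi.zero_apply, zero_add, mul_assoc]
  · rw [quantizedCoord_inr_mul_gaussianWave hħ a b hM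
      (quantizedCoord_gaussianWave hħ a b hM β) (hasLineDerivAt_gaussianSymbol ħ b M x j β),
      Sum.elim_inr]

theorem weylHamiltonian_apply_of_isSymm (ħ : ℝ) {R : Matrix (Fin n ⊕ Fin n) (Fin n ⊕ Fin n) ℝ}
    (hR : R.IsSymm) (φ : 𝓢(ConfigSpace n, ℂ)) (x : ConfigSpace n) :
    weylHamiltonian ħ R φ x =
      1 / 2 * ∑ α, ∑ β, (R α β : ℂ) * quantizedCoord ħ α (quantizedCoord ħ β φ) x := by
  have hswap : ∑ α, ∑ β, (R α β : ℂ) * quantizedCoord ħ β (quantizedCoord ħ α φ) x =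
      ∑ α, ∑ β, (R α β : ℂ) * quantizedCoord ħ α (quantizedCoord ħ β φ) x := by
    rw [Finset.sum_comm]
    simp only [hR.apply]
  simp only [weylHamiltonian, smul_apply, sum_apply, add_apply, ContinuousLinearMap.comp_apply,
    smul_eq_mul, mul_add, Finset.sum_add_distrib, mul_left_comm _ (1 / 2 : ℂ),
    ← Finset.mul_sum, hswap]
  ring

/-- The lower block of `R (1, iM)`: it generates the motion of the upper block of the frame
`(1, iM)` under the flow of `½ R z · z`. -/
def flowGenerator (R : Matrix (Fin n ⊕ Fin n) (Fin n ⊕ Fin n) ℝ)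
    (M : Matrix (Fin n) (Fin n) ℂ) : Matrix (Fin n) (Fin n) ℂ :=
  (toComplex R * lagrangianFrame M).toRows₂

/-- The velocity of the coefficients `(a, b, M)` of a Gaussian wave under Schrödinger's equation
with Hamiltonian `½ R z · z`. Its last component is the Riccati equation `M' = i Wᵀ R W` for the
frame `W = (1, iM)`. -/
def gaussianVelocity (ħ : ℝ) (R : Matrix (Fin n ⊕ Fin n) (Fin n ⊕ Fin n) ℝ) (b : Fin n → ℂ)
    (M : Matrix (Fin n) (Fin n) ℂ) : ℂ × (Fin n → ℂ) × Matrix (Fin n) (Fin n) ℂ :=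
  (Complex.I * ħ / 2 * (((toComplex R).toBlocks₂₂ *ᵥ b) ⬝ᵥ b) - 1 / 2 * (flowGenerator R M).trace,
    -((flowGenerator R M)ᵀ *ᵥ b),
    Complex.I • ((lagrangianFrame M)ᵀ * (toComplex R * lagrangianFrame M)))

theorem weylHamiltonian_gaussianWave {R : Matrix (Fin n ⊕ Fin n) (Fin n ⊕ Fin n) ℝ}
    (hR : R.IsSymm) (x : ConfigSpace n) :
    weylHamiltonian ħ R (gaussianWave hħ a b hM) x =
      1 / 2 * ((toComplex R *ᵥ gaussianSymbol ħ b M x) ⬝ᵥ gaussianSymbol ħ b M x -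
        Complex.I * ħ * (flowGenerator R M).trace) * gaussianWave hħ a b hM x := by
  have hordering : ∑ α, ∑ β, (R α β : ℂ) *
      Sum.elim (0 : Fin n → ℂ) (fun j => -(Complex.I * ħ) * lagrangianFrame M β j) α =
      -(Complex.I * ħ) * (flowGenerator R M).trace := by
    rw [Fintype.sum_sum_type]
    simp only [Sum.elim_inl, Sum.elim_inr, Pi.zero_apply, mul_zero, Finset.sum_const_zero, zero_add,
      mul_left_comm _ (-(Complex.I * ħ)), ← Finset.mul_sum]
    rfl
  have hsymbol : ∑ α, ∑ β, (R α β : ℂ) * (gaussianSymbol ħ b M x α * gaussianSymbol ħ b M x β) =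
      (toComplex R *ᵥ gaussianSymbol ħ b M x) ⬝ᵥ gaussianSymbol ħ b M x := by
    simp only [Matrix.mulVec, dotProduct, Finset.sum_mul]
    exact Finset.sum_congr rfl fun α _ => Finset.sum_congr rfl fun β _ => by
      rw [toComplex_apply]
      ring
  simp only [weylHamiltonian_apply_of_isSymm ħ hR, quantizedCoord_quantizedCoord_gaussianWave,
    ← mul_assoc, ← Finset.sum_mul]
  simp only [mul_assoc, mul_add, Finset.sum_add_distrib, hordering, hsymbol]
  ring

theorem mulVec_gaussianSymbol_dotProduct {R : Matrix (Fin n ⊕ Fin n) (Fin n ⊕ Fin n) ℝ}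
    (hR : R.IsSymm) (ħ : ℝ) (b : Fin n → ℂ) (M : Matrix (Fin n) (Fin n) ℂ) (x : ConfigSpace n) :
    (toComplex R *ᵥ gaussianSymbol ħ b M x) ⬝ᵥ gaussianSymbol ħ b M x =
      (((lagrangianFrame M)ᵀ * (toComplex R * lagrangianFrame M)) *ᵥ toComplexVec x.ofLp) ⬝ᵥ
          toComplexVec x.ofLp -
        2 * (Complex.I * ħ) * (((flowGenerator R M)ᵀ *ᵥ b) ⬝ᵥ toComplexVec x.ofLp) -
        ħ ^ 2 * (((toComplex R).toBlocks₂₂ *ᵥ b) ⬝ᵥ b) := by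
  have hRC : (toComplex R).IsSymm := by rw [Matrix.IsSymm, ← toComplex_transpose, hR.eq]
  set v := toComplexVec x.ofLp
  set η : Fin n ⊕ Fin n → ℂ := Sum.elim 0 (-(Complex.I * ħ) • b)
  have hζ : gaussianSymbol ħ b M x = lagrangianFrame M *ᵥ v + η := rfl
  have hη (u : Fin n ⊕ Fin n → ℂ) : u ⬝ᵥ η = -(Complex.I * ħ) * ((u ∘ Sum.inr) ⬝ᵥ b) := by
    simp [η, dotProduct, Finset.mul_sum, mul_left_comm]
  have hquadratic : (toComplex R *ᵥ (lagrangianFrame M *ᵥ v)) ⬝ᵥ (lagrangianFrame M *ᵥ v) =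
      (((lagrangianFrame M)ᵀ * (toComplex R * lagrangianFrame M)) *ᵥ v) ⬝ᵥ v := by
    simp only [← Matrix.mulVec_mulVec, Matrix.dotProduct_mulVec, ← Matrix.mulVec_transpose]
  have hcross : (toComplex R *ᵥ (lagrangianFrame M *ᵥ v)) ⬝ᵥ η =
      -(Complex.I * ħ) * (((flowGenerator R M)ᵀ *ᵥ b) ⬝ᵥ v) := by
    rw [hη, Matrix.mulVec_mulVec, Matrix.mulVec_transpose, ← Matrix.dotProduct_mulVec,
      dotProduct_comm b]
    rfl
  have hconst : (toComplex R *ᵥ η) ⬝ᵥ η =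
      -ħ ^ 2 * (((toComplex R).toBlocks₂₂ *ᵥ b) ⬝ᵥ b) := by
    have hRη : (toComplex R *ᵥ η) ∘ Sum.inr =
        (-(Complex.I * ħ)) • ((toComplex R).toBlocks₂₂ *ᵥ b) := by
      conv_lhs => rw [← Matrix.fromBlocks_toBlocks (toComplex R)]
      simp [η, Matrix.fromBlocks_mulVec, Matrix.mulVec_smul, Matrix.mulVec_neg]
    rw [hη, hRη, smul_dotProduct, smul_eq_mul]
    linear_combination ħ ^ 2 * (((toComplex R).toBlocks₂₂ *ᵥ b) ⬝ᵥ b) * Complex.I_sq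
  rw [hζ, Matrix.mulVec_add, add_dotProduct, dotProduct_add, dotProduct_add, hquadratic, hcross,
    hconst, dotProduct_mulVec_symm hRC η, dotProduct_comm η, hcross]
  ring

theorem weylHamiltonian_gaussianWave_eq_mul_gaussianExponent
    {R : Matrix (Fin n ⊕ Fin n) (Fin n ⊕ Fin n) ℝ} (hR : R.IsSymm) (x : ConfigSpace n) :
    weylHamiltonian ħ R (gaussianWave hħ a b hM) x =
      Complex.I * ħ * gaussianExponent ħ (gaussianVelocity ħ R b M) x *
        gaussianWave hħ a b hM x := by
  have hħ' : (ħ : ℂ) ≠ 0 := by exact_mod_cast hħ.ne'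
  rw [weylHamiltonian_gaussianWave hħ a b hM hR, mulVec_gaussianSymbol_dotProduct hR,
    gaussianVelocity, gaussianExponent_apply, neg_dotProduct, Matrix.smul_mulVec, smul_dotProduct,
    smul_eq_mul]
  field_simp
  ring_nf
  simp only [Complex.I_sq]
  ring

end WeylAction

/-! ### The Riccati equation -/

section Riccati

variable {R : Matrix (Fin n ⊕ Fin n) (Fin n ⊕ Fin n) ℝ} {M : Matrix (Fin n) (Fin n) ℂ}

theorem siegelDenominator_one (M : Matrix (Fin n) (Fin n) ℂ) : siegelDenominator 1 M = 1 := by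
  simp [siegelDenominator, lagrangianFrame]

theorem siegelAction_one (M : Matrix (Fin n) (Fin n) ℂ) : siegelAction 1 M = M := by
  simp [siegelAction, siegelDenominator_one, lagrangianFrame, smul_smul]

theorem transpose_lagrangianFrame_mul {m : Type*} (M : Matrix (Fin n) (Fin n) ℂ)
    (U : Matrix (Fin n ⊕ Fin n) m ℂ) :
    (lagrangianFrame M)ᵀ * U = U.toRows₁ + Complex.I • (Mᵀ * U.toRows₂) := by
  conv_lhs => rw [← Matrix.fromRows_toRows U, lagrangianFrame, Matrix.transpose_fromRows,
    Matrix.fromCols_mul_fromRows]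
  simp

theorem hasDerivAt_toComplex_classicalFlow (R : Matrix (Fin n ⊕ Fin n) (Fin n ⊕ Fin n) ℝ)
    (t : ℝ) : HasDerivAt (fun s => toComplex (classicalFlow R s))
      (toComplex (standardJ n) * toComplex R * toComplex (classicalFlow R t)) t := by
  rw [← map_mul, ← map_mul]
  exact hasDerivAt_matrix_iff.2 fun i j =>
    (hasDerivAt_matrix_iff.1 (hasDerivAt_classicalFlow R t) i j).ofReal_comp

theorem hasDerivAt_toComplex_classicalFlow_mul_frame (hR : R.IsSymm) (hM : IsSiegel M) (t : ℝ) :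
    HasDerivAt (fun s => toComplex (classicalFlow R s) * lagrangianFrame M)
      (Matrix.fromRows
        (flowGenerator R (siegelAction (classicalFlow R t) M) *
          siegelDenominator (classicalFlow R t) M)
        (-((toComplex R * lagrangianFrame (siegelAction (classicalFlow R t) M)).toRows₁ *
          siegelDenominator (classicalFlow R t) M))) t := by
  convert! hasDerivAt_matrix_mul (hasDerivAt_toComplex_classicalFlow R t)
    (hasDerivAt_matrix_const (lagrangianFrame M) t) using 1
  rw [Matrix.mul_zero, add_zero, Matrix.mul_assoc, Matrix.mul_assoc,
    toComplex_mul_lagrangianFrame (classicalFlow_mem_symplecticGroup hR t) hM,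
    ← Matrix.mul_assoc (toComplex R),
    ← Matrix.fromRows_toRows (toComplex R * lagrangianFrame _), Matrix.fromRows_mul,
    toComplex_standardJ_mul_fromRows]
  rfl

theorem hasDerivAt_siegelDenominator (hR : R.IsSymm) (hM : IsSiegel M) (t : ℝ) :
    HasDerivAt (fun s => siegelDenominator (classicalFlow R s) M)
      (flowGenerator R (siegelAction (classicalFlow R t) M) *
        siegelDenominator (classicalFlow R t) M) t := by
  have hF := hasDerivAt_toComplex_classicalFlow_mul_frame hR hM t
  exact hasDerivAt_matrix_iff.2 fun i j => hasDerivAt_matrix_iff.1 hF (Sum.inl i) j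

theorem hasDerivAt_siegelAction (hR : R.IsSymm) (hM : IsSiegel M) (t : ℝ) :
    HasDerivAt (fun s => siegelAction (classicalFlow R s) M)
      (Complex.I • ((lagrangianFrame (siegelAction (classicalFlow R t) M))ᵀ *
        (toComplex R * lagrangianFrame (siegelAction (classicalFlow R t) M)))) t := by
  have hS := classicalFlow_mem_symplecticGroup hR t
  have hP := isUnit_siegelDenominator hS hM
  have hPdet := (Matrix.isUnit_iff_isUnit_det _).1 hP
  have hF := hasDerivAt_toComplex_classicalFlow_mul_frame hR hM t
  have hN : HasDerivAt (fun s => (toComplex (classicalFlow R s) * lagrangianFrame M).toRows₂)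
      (-((toComplex R * lagrangianFrame (siegelAction (classicalFlow R t) M)).toRows₁ *
        siegelDenominator (classicalFlow R t) M)) t :=
    hasDerivAt_matrix_iff.2 fun i j => hasDerivAt_matrix_iff.1 hF (Sum.inr i) j
  have hquotient := hasDerivAt_matrix_mul hN
    (hasDerivAt_matrix_inv (hasDerivAt_siegelDenominator hR hM t) hP)
  have hNP : (toComplex (classicalFlow R t) * lagrangianFrame M).toRows₂ *
      (siegelDenominator (classicalFlow R t) M)⁻¹ =
        Complex.I • siegelAction (classicalFlow R t) M := by
    simp [siegelAction, smul_smul]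
  refine hasDerivAt_matrix_iff.2 fun i j => ?_
  convert! (hasDerivAt_matrix_iff.1 hquotient i j).const_mul (-Complex.I) using 1
  rw [← smul_eq_mul, ← Matrix.smul_apply, transpose_lagrangianFrame_mul,
    (isSiegel_siegelAction hS hM).1.eq, Matrix.mul_assoc _ _ (_⁻¹),
    Matrix.mul_nonsing_inv_cancel_right _ _ hPdet, Matrix.mul_neg, ← Matrix.mul_assoc, hNP,
    Matrix.neg_mul, Matrix.mul_nonsing_inv_cancel_right _ _ hPdet]
  simp [flowGenerator]
  ring

end Riccati

section CoherentCoefficients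

attribute [local instance] Matrix.linftyOpNormedAddCommGroup Matrix.linftyOpNormedSpace

/-- The coefficient `b` of the Gaussian wave `exp (a + b · x - (1/2ħ) M x · x)` centred at the
phase-space point `z`. -/
def linearCoefficient (ħ : ℝ) (M : Matrix (Fin n) (Fin n) ℂ) (z : PhaseSpace n) : Fin n → ℂ :=
  (Complex.I / ħ) • ((lagrangianFrame M)ᵀ *ᵥ (toComplex (standardJ n) *ᵥ toComplexVec z.ofLp))

/-- The coefficients `(a, b, M)` of the Gaussian wave centred at the phase-space point `z`; the
number `c` is the logarithm of its complex amplitude relative to `heisenbergWeyl`. -/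
def coherentCoefficients (ħ : ℝ) (c : ℂ) (M : Matrix (Fin n) (Fin n) ℂ) (z : PhaseSpace n) :
    ℂ × (Fin n → ℂ) × Matrix (Fin n) (Fin n) ℂ :=
  (c - 1 / 2 * (toComplexVec (position z).ofLp ⬝ᵥ linearCoefficient ħ M z),
    linearCoefficient ħ M z, M)

variable {ħ : ℝ} {M : Matrix (Fin n) (Fin n) ℂ} {R S : Matrix (Fin n ⊕ Fin n) (Fin n ⊕ Fin n) ℝ}

theorem linearCoefficient_eq (ħ : ℝ) (hM : M.IsSymm) (z : PhaseSpace n) :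
    linearCoefficient ħ M z = (1 / (ħ : ℂ)) • (M *ᵥ toComplexVec (position z).ofLp +
      Complex.I • toComplexVec (momentum z).ofLp) := by
  have hz : toComplexVec z.ofLp =
      Sum.elim (toComplexVec (position z).ofLp) (toComplexVec (momentum z).ofLp) := by
    ext (j | j) <;> rfl
  rw [linearCoefficient, hz, toComplex_standardJ_mulVec_elim, lagrangianFrame,
    Matrix.transpose_fromRows, Matrix.fromCols_mulVec]
  simp only [Matrix.transpose_one, Matrix.one_mulVec, Matrix.transpose_smul, hM.eq,
    Matrix.smul_mulVec, Matrix.mulVec_neg, Sum.elim_comp_inl, Sum.elim_comp_inr]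
  ext j
  simp only [Pi.smul_apply, Pi.add_apply, Pi.neg_apply, smul_eq_mul]
  linear_combination (-(M *ᵥ toComplexVec (position z).ofLp) j / ħ) * Complex.I_sq

theorem gaussianSymbol_position (hħ : ħ ≠ 0) (hM : M.IsSymm) (z : PhaseSpace n) :
    gaussianSymbol ħ (linearCoefficient ħ M z) M (position z) = toComplexVec z.ofLp := by
  have hħ' : (ħ : ℂ) ≠ 0 := by exact_mod_cast hħ
  ext (j | j)
  · rw [gaussianSymbol_inl]
    rfl
  · have hp : toComplexVec z.ofLp (Sum.inr j) = toComplexVec (momentum z).ofLp j := rfl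
    rw [gaussianSymbol_inr, linearCoefficient_eq ħ hM, hp]
    simp only [Pi.smul_apply, Pi.add_apply, smul_eq_mul]
    field_simp
    linear_combination -toComplexVec (momentum z).ofLp j * Complex.I_sq

theorem linearCoefficient_siegelAction (ħ : ℝ) (hS : S ∈ Matrix.symplecticGroup (Fin n) ℝ)
    (hM : IsSiegel M) (z : PhaseSpace n) :
    linearCoefficient ħ (siegelAction S M) (Matrix.toEuclideanLin S z) =
      ((siegelDenominator S M)⁻¹)ᵀ *ᵥ linearCoefficient ħ M z := by
  have hP := (Matrix.isUnit_iff_isUnit_det _).1 (isUnit_siegelDenominator hS hM)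
  have hSz : toComplexVec (Matrix.toEuclideanLin S z).ofLp = toComplex S *ᵥ toComplexVec z.ofLp :=
    (toComplex_mulVec_toComplexVec S z.ofLp).symm
  have hframe : (lagrangianFrame M)ᵀ * toComplex (standardJ n) =
      (siegelDenominator S M)ᵀ * ((lagrangianFrame (siegelAction S M))ᵀ *
        (toComplex (standardJ n) * toComplex S)) := by
    rw [← Matrix.mul_assoc, ← Matrix.transpose_mul, ← toComplex_mul_lagrangianFrame hS hM,
      Matrix.transpose_mul, ← toComplex_transpose, Matrix.mul_assoc,
      toComplex_transpose_mul_standardJ_mul hS]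
  have hcancel : ((siegelDenominator S M)⁻¹)ᵀ * (siegelDenominator S M)ᵀ = 1 := by
    rw [← Matrix.transpose_mul, Matrix.mul_nonsing_inv _ hP, Matrix.transpose_one]
  simp only [linearCoefficient, hSz, Matrix.mulVec_smul, Matrix.mulVec_mulVec, hframe]
  rw [← Matrix.mul_assoc _ᵀ _ᵀ, hcancel, Matrix.one_mul]

theorem hasDerivAt_linearCoefficient (ħ : ℝ) (hR : R.IsSymm) (hM : IsSiegel M) (z : PhaseSpace n)
    (t : ℝ) :
    HasDerivAt (fun s => linearCoefficient ħ (siegelAction (classicalFlow R s) M)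
        (Matrix.toEuclideanLin (classicalFlow R s) z))
      (-((flowGenerator R (siegelAction (classicalFlow R t) M))ᵀ *ᵥ
        linearCoefficient ħ (siegelAction (classicalFlow R t) M)
          (Matrix.toEuclideanLin (classicalFlow R t) z))) t := by
  have hS (s : ℝ) := classicalFlow_mem_symplecticGroup hR s
  have hP := isUnit_siegelDenominator (hS t) hM
  have hinv := hasDerivAt_matrix_inv (hasDerivAt_siegelDenominator hR hM t) hP
  rw [← Matrix.mul_assoc (_⁻¹), Matrix.mul_nonsing_inv_cancel_right _ _
    ((Matrix.isUnit_iff_isUnit_det _).1 hP)] at hinv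
  have hinvT : HasDerivAt (fun s => ((siegelDenominator (classicalFlow R s) M)⁻¹)ᵀ)
      (-((flowGenerator R (siegelAction (classicalFlow R t) M))ᵀ *
        ((siegelDenominator (classicalFlow R t) M)⁻¹)ᵀ)) t := by
    rw [← Matrix.transpose_mul, ← Matrix.transpose_neg]
    exact hasDerivAt_matrix_iff.2 fun i j => hasDerivAt_matrix_iff.1 hinv j i
  simp only [linearCoefficient_siegelAction ħ (hS _) hM]
  refine (hasDerivAt_mulVec hinvT (hasDerivAt_const t _)).congr_deriv ?_
  rw [Matrix.mulVec_zero, add_zero, Matrix.neg_mulVec, Matrix.mulVec_mulVec]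

theorem hasDerivAt_position_classicalFlow (hħ : ħ ≠ 0) (hR : R.IsSymm) (hM : IsSiegel M)
    (z : PhaseSpace n) (t : ℝ) :
    HasDerivAt (fun s => toComplexVec (position (Matrix.toEuclideanLin (classicalFlow R s) z)).ofLp)
      (flowGenerator R (siegelAction (classicalFlow R t) M) *ᵥ
          toComplexVec (position (Matrix.toEuclideanLin (classicalFlow R t) z)).ofLp -
        (Complex.I * ħ) • ((toComplex R).toBlocks₂₂ *ᵥ
          linearCoefficient ħ (siegelAction (classicalFlow R t) M)
            (Matrix.toEuclideanLin (classicalFlow R t) z))) t := by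
  have hS := classicalFlow_mem_symplecticGroup hR t
  have hflow (s : ℝ) : toComplexVec (Matrix.toEuclideanLin (classicalFlow R s) z).ofLp =
      toComplex (classicalFlow R s) *ᵥ toComplexVec z.ofLp :=
    (toComplex_mulVec_toComplexVec _ z.ofLp).symm
  set M' := siegelAction (classicalFlow R t) M
  set z' := Matrix.toEuclideanLin (classicalFlow R t) z
  have hz' := gaussianSymbol_position hħ (isSiegel_siegelAction hS hM).1 z'
  have hR' : (toComplex R *ᵥ toComplexVec z'.ofLp) ∘ Sum.inr =
      flowGenerator R M' *ᵥ toComplexVec (position z').ofLp -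
        (Complex.I * ħ) • ((toComplex R).toBlocks₂₂ *ᵥ linearCoefficient ħ M' z') := by
    have hconst : (toComplex R *ᵥ Sum.elim (0 : Fin n → ℂ)
        (-(Complex.I * ħ) • linearCoefficient ħ M' z')) ∘ Sum.inr =
        -((Complex.I * ħ) • ((toComplex R).toBlocks₂₂ *ᵥ linearCoefficient ħ M' z')) := by
      conv_lhs => rw [← Matrix.fromBlocks_toBlocks (toComplex R)]
      simp [Matrix.fromBlocks_mulVec, Matrix.mulVec_smul, Matrix.mulVec_neg]
    rw [← hz', gaussianSymbol, Matrix.mulVec_add, Matrix.mulVec_mulVec, sub_eq_add_neg, ← hconst]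
    rfl
  have hpoint := hasDerivAt_mulVec (hasDerivAt_toComplex_classicalFlow R t)
    (hasDerivAt_const t (toComplexVec z.ofLp))
  rw [Matrix.mulVec_zero, add_zero, ← Matrix.mulVec_mulVec, ← Matrix.mulVec_mulVec, ← hflow,
    ← Sum.elim_comp_inl_inr (toComplex R *ᵥ _), toComplex_standardJ_mulVec_elim, hR'] at hpoint
  simp only [← hflow] at hpoint
  exact hasDerivAt_pi.2 fun j => hasDerivAt_pi.1 hpoint (Sum.inl j)

theorem hasDerivAt_coherentCoefficients (hħ : ħ ≠ 0) (hR : R.IsSymm) (hM : IsSiegel M)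
    (z : PhaseSpace n) {c : ℝ → ℂ} {t : ℝ}
    (hc : HasDerivAt c
      (-(1 / 2) * (flowGenerator R (siegelAction (classicalFlow R t) M)).trace) t) :
    HasDerivAt (fun s => coherentCoefficients ħ (c s) (siegelAction (classicalFlow R s) M)
        (Matrix.toEuclideanLin (classicalFlow R s) z))
      (gaussianVelocity ħ R (linearCoefficient ħ (siegelAction (classicalFlow R t) M)
        (Matrix.toEuclideanLin (classicalFlow R t) z)) (siegelAction (classicalFlow R t) M)) t := by
  have hb := hasDerivAt_linearCoefficient ħ hR hM z t
  have hq := hasDerivAt_position_classicalFlow hħ hR hM z t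
  have ha := hc.sub ((hasDerivAt_dotProduct hq hb).const_mul (1 / 2))
  have hM' := hasDerivAt_siegelAction hR hM t
  simp only [coherentCoefficients, gaussianVelocity]
  convert! ha.prodMk (hb.prodMk hM') using 2
  rw [sub_dotProduct, smul_dotProduct, smul_eq_mul, dotProduct_neg, Matrix.dotProduct_mulVec,
    Matrix.vecMul_transpose]
  ring

end CoherentCoefficients

/-! ### Evolution of Gaussian waves -/

section StrongEvolution

attribute [local instance] Matrix.linftyOpNormedAddCommGroup Matrix.linftyOpNormedSpace

theorem norm_dotProduct_le_card_mul {ι A : Type*} [Fintype ι] [NonUnitalSeminormedRing A]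
    (u v : ι → A) : ‖u ⬝ᵥ v‖ ≤ Fintype.card ι * (‖u‖ * ‖v‖) := by
  calc ‖u ⬝ᵥ v‖ ≤ ∑ i, ‖u i * v i‖ := norm_sum_le _ _
    _ ≤ ∑ _i : ι, ‖u‖ * ‖v‖ := by
      gcongr with i
      exact (norm_mul_le _ _).trans (by gcongr <;> exact norm_le_pi_norm _ i)
    _ = _ := by simp

theorem norm_toComplexVec_le {ι : Type*} [Fintype ι] (v : EuclideanSpace ℝ ι) :
    ‖toComplexVec v.ofLp‖ ≤ ‖v‖ :=
  (pi_norm_le_iff_of_nonneg (norm_nonneg v)).2 fun i => by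
    simpa [toComplexVec] using PiLp.norm_apply_le v i

theorem exists_norm_gaussianExponent_le (n : ℕ) (ħ : ℝ) :
    ∃ C > 0, ∀ (κ : ℂ × (Fin n → ℂ) × Matrix (Fin n) (Fin n) ℂ) (x : ConfigSpace n),
      ‖gaussianExponent ħ κ x‖ ≤ ‖κ‖ * (C * (1 + ‖x‖ ^ 2)) := by
  refine ⟨1 + n * (1 + ‖(1 / (2 * ħ) : ℂ)‖), by positivity, fun κ x => ?_⟩
  obtain ⟨a, b, M⟩ := κ
  set v := toComplexVec x.ofLp
  set N := ‖(a, b, M)‖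
  have hv : ‖v‖ ≤ ‖x‖ := norm_toComplexVec_le x
  have ha : ‖a‖ ≤ N := norm_fst_le (a, b, M)
  have hb : ‖b‖ ≤ N := (norm_fst_le (b, M)).trans (norm_snd_le (a, b, M))
  have hM : ‖M‖ ≤ N := (norm_snd_le (b, M)).trans (norm_snd_le (a, b, M))
  have hlinear : ‖b ⬝ᵥ v‖ ≤ n * (N * ‖x‖) := by
    refine (norm_dotProduct_le_card_mul b v).trans ?_
    rw [Fintype.card_fin]
    gcongr
  have hquadratic : ‖(M *ᵥ v) ⬝ᵥ v‖ ≤ n * (N * ‖x‖ * ‖x‖) := by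
    refine (norm_dotProduct_le_card_mul _ v).trans ?_
    rw [Fintype.card_fin]
    gcongr
    exact (Matrix.linfty_opNorm_mulVec M v).trans (by gcongr)
  have hx : ‖x‖ ≤ 1 + ‖x‖ ^ 2 := by nlinarith [sq_nonneg (‖x‖ - 1)]
  rw [gaussianExponent_apply]
  calc _ ≤ ‖a‖ + ‖b ⬝ᵥ v‖ + ‖(1 / (2 * ħ) : ℂ)‖ * ‖(M *ᵥ v) ⬝ᵥ v‖ := by
        rw [← norm_mul]
        exact (norm_sub_le _ _).trans (by gcongr; exact norm_add_le _ _)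
    _ ≤ N * (1 + ‖x‖ ^ 2) + n * (N * (1 + ‖x‖ ^ 2)) +
          ‖(1 / (2 * ħ) : ℂ)‖ * (n * (N * (1 + ‖x‖ ^ 2))) := by
        gcongr
        · exact ha.trans (le_mul_of_one_le_right (norm_nonneg _) (by nlinarith))
        · exact hlinear.trans (by gcongr)
        · refine hquadratic.trans ?_
          rw [mul_assoc]
          gcongr
          nlinarith
    _ = _ := by ring

variable {ħ : ℝ} (hħ : 0 < ħ) {M : Matrix (Fin n) (Fin n) ℂ}
  {R : Matrix (Fin n ⊕ Fin n) (Fin n ⊕ Fin n) ℝ}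

/-- The Gaussian wave centred at the phase-space point `z`, with complex amplitude `exp c`
relative to `heisenbergWeyl`. -/
def coherentWave (c : ℂ) (hM : IsSiegel M) (z : PhaseSpace n) : 𝓢(ConfigSpace n, ℂ) :=
  gaussianWave hħ (coherentCoefficients ħ c M z).1 (linearCoefficient ħ M z) hM

theorem coherentWave_apply (c : ℂ) (hM : IsSiegel M) (z : PhaseSpace n) (x : ConfigSpace n) :
    coherentWave hħ c hM z x = Complex.exp (gaussianExponent ħ (coherentCoefficients ħ c M z) x) :=
  rfl

/-- The logarithm of the complex amplitude of an evolving Gaussian wave. -/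
def logAmplitude (R : Matrix (Fin n ⊕ Fin n) (Fin n ⊕ Fin n) ℝ) (M : Matrix (Fin n) (Fin n) ℂ)
    (c : ℂ) (t : ℝ) : ℂ :=
  c + ∫ s in (0 : ℝ)..t,
    -(1 / 2) * (flowGenerator R (siegelAction (classicalFlow R s) M)).trace

theorem hasDerivAt_logAmplitude (hR : R.IsSymm) (hM : IsSiegel M) (c : ℂ) (t : ℝ) :
    HasDerivAt (logAmplitude R M c)
      (-(1 / 2) * (flowGenerator R (siegelAction (classicalFlow R t) M)).trace) t := by
  have hM' : Continuous fun s => siegelAction (classicalFlow R s) M :=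
    continuous_iff_continuousAt.2 fun s => (hasDerivAt_siegelAction hR hM s).continuousAt
  have hframe : Continuous fun s =>
      toComplex R * lagrangianFrame (siegelAction (classicalFlow R s) M) :=
    continuous_const.matrix_mul (continuous_matrix fun i j => by
      rcases i with i | i
      · exact continuous_const
      · exact continuous_const.mul (hM'.matrix_elem i j))
  have htrace : Continuous fun s =>
      (flowGenerator R (siegelAction (classicalFlow R s) M)).trace :=
    Continuous.matrix_trace (continuous_matrix fun i j => hframe.matrix_elem (Sum.inr i) j)
  exact ((continuous_const.mul htrace).integral_hasStrictDerivAt 0 t).hasDerivAt.const_add c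

/-- The Gaussian wave transported by Schrödinger's equation: its centre moves along the classical
trajectory and its Lagrangian frame is carried along by the classical flow. -/
def evolvedWave (hR : R.IsSymm) (c : ℂ) (hM : IsSiegel M) (z : PhaseSpace n) (t : ℝ) :
    𝓢(ConfigSpace n, ℂ) :=
  coherentWave hħ (logAmplitude R M c t)
    (isSiegel_siegelAction (classicalFlow_mem_symplecticGroup hR t) hM)
    (Matrix.toEuclideanLin (classicalFlow R t) z)

theorem evolvedWave_zero (hR : R.IsSymm) (c : ℂ) (hM : IsSiegel M) (z : PhaseSpace n) :
    evolvedWave hħ hR c hM z 0 = coherentWave hħ c hM z := by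
  ext x
  simp only [evolvedWave, coherentWave_apply, classicalFlow_zero, siegelAction_one, logAmplitude,
    intervalIntegral.integral_same, add_zero, Matrix.toLpLin_one, LinearMap.id_apply]

theorem hasDerivAt_toLp_evolvedWave (hR : R.IsSymm) (c : ℂ) (hM : IsSiegel M) (z : PhaseSpace n)
    (t : ℝ) :
    HasDerivAt (fun s => (evolvedWave hħ hR c hM z s).toLp 2 (volume : Measure (ConfigSpace n)))
      ((Complex.I * (ħ : ℂ))⁻¹ • (weylHamiltonian ħ R (evolvedWave hħ hR c hM z t)).toLp 2 volume)
      t := by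
  obtain ⟨C, hC, hbound⟩ := exists_norm_gaussianExponent_le n ħ
  have hκ := hasDerivAt_coherentCoefficients hħ.ne' hR hM z (hasDerivAt_logAmplitude hR hM c t)
  obtain ⟨δ, hδ, hmem⟩ := (hasGaussianDecay_gaussianExponent hħ
    (coherentCoefficients ħ (logAmplitude R M c t) (siegelAction (classicalFlow R t) M)
      (Matrix.toEuclideanLin (classicalFlow R t) z)).1
    (linearCoefficient ħ (siegelAction (classicalFlow R t) M)
      (Matrix.toEuclideanLin (classicalFlow R t) z))
    (isSiegel_siegelAction (classicalFlow_mem_symplecticGroup hR t) hM)).exists_memLp_exp_add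
      (p := 2) (μ := volume) hC
  refine hasDerivAt_Lp_cexp (fun x => by positivity) hbound hκ hδ hmem
    (fun s => SchwartzMap.coeFn_toLp _ 2 volume) ?_
  filter_upwards [Lp.coeFn_smul (Complex.I * (ħ : ℂ))⁻¹
      ((weylHamiltonian ħ R (evolvedWave hħ hR c hM z t)).toLp 2 volume),
    SchwartzMap.coeFn_toLp (weylHamiltonian ħ R (evolvedWave hħ hR c hM z t)) 2 volume]
    with x hsmul hx
  rw [hsmul, Pi.smul_apply, hx, smul_eq_mul]
  have hħ' : (Complex.I * ħ : ℂ) ≠ 0 := mul_ne_zero Complex.I_ne_zero (by exact_mod_cast hħ.ne')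
  rw [evolvedWave, coherentWave,
    weylHamiltonian_gaussianWave_eq_mul_gaussianExponent hħ _ _ _ hR, mul_assoc,
    inv_mul_cancel_left₀ hħ']
  rfl

end StrongEvolution

/-! ### Uniqueness for Schrödinger's equation -/

section WeakSolutions

open Filter Topology

theorem inner_quantizedCoord (ħ : ℝ) (α : Fin n ⊕ Fin n) (φ ψ : 𝓢(ConfigSpace n, ℂ)) :
    inner ℂ ((quantizedCoord ħ α φ).toLp 2 volume) (ψ.toLp 2 volume) =
      inner ℂ (φ.toLp 2 volume) ((quantizedCoord ħ α ψ).toLp 2 volume) := by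
  simp only [SchwartzMap.inner_toL2_toL2_eq, RCLike.inner_apply']
  rcases α with j | j
  · refine integral_congr_ae (Eventually.of_forall fun x => ?_)
    simp only [quantizedCoord_inl_apply, map_mul, Complex.conj_ofReal]
    ring
  · have integral_by_parts :
        ∫ x, (starRingEnd ℂ) (φ x) * lineDeriv ℝ ψ x (EuclideanSpace.single j (1 : ℝ)) =
          -∫ x, (starRingEnd ℂ) (lineDeriv ℝ φ x (EuclideanSpace.single j (1 : ℝ))) * ψ x := by
      have h := SchwartzMap.integral_bilinear_lineDerivOp_right_eq_neg_left (μ := volume) φ ψ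
        ((ContinuousLinearMap.mul ℝ ℂ).comp (Complex.conjCLE : ℂ →L[ℝ] ℂ))
        (EuclideanSpace.single j (1 : ℝ))
      simp only [ContinuousLinearMap.comp_apply, ContinuousLinearMap.mul_apply',
        SchwartzMap.lineDerivOp_apply] at h
      exact h
    calc _ = ∫ x, Complex.I * ħ * ((starRingEnd ℂ) (lineDeriv ℝ φ x
          (EuclideanSpace.single j (1 : ℝ))) * ψ x) := by
          refine integral_congr_ae (Eventually.of_forall fun x => ?_)
          simp only [quantizedCoord_inr_apply, map_mul, map_neg, Complex.conj_I,
            Complex.conj_ofReal]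
          ring
      _ = ∫ x, -(Complex.I * ħ) * ((starRingEnd ℂ) (φ x) * lineDeriv ℝ ψ x
          (EuclideanSpace.single j (1 : ℝ))) := by
          rw [integral_const_mul, integral_const_mul, integral_by_parts, neg_mul_neg]
      _ = _ := by
          simp only [quantizedCoord_inr_apply, mul_left_comm]

theorem inner_weylHamiltonian (ħ : ℝ) (R : Matrix (Fin n ⊕ Fin n) (Fin n ⊕ Fin n) ℝ)
    (φ ψ : 𝓢(ConfigSpace n, ℂ)) :
    inner ℂ ((weylHamiltonian ħ R φ).toLp 2 volume) (ψ.toLp 2 volume) =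
      inner ℂ (φ.toLp 2 volume) ((weylHamiltonian ħ R ψ).toLp 2 volume) := by
  simp only [← SchwartzMap.toLpCLM_apply (𝕜 := ℂ)]
  simp only [weylHamiltonian, smul_apply, sum_apply, add_apply, ContinuousLinearMap.comp_apply,
    map_smul, map_sum, map_add, inner_smul_left, inner_smul_right, sum_inner, inner_sum,
    inner_add_left, inner_add_right]
  simp only [SchwartzMap.toLpCLM_apply, inner_quantizedCoord]
  simp only [map_div₀, map_one, map_ofNat, Complex.conj_ofReal]
  congr 1
  refine Finset.sum_congr rfl fun α _ => Finset.sum_congr rfl fun β _ => ?_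
  ring

theorem hasDerivAt_inner_of_hasDerivAt_inner_const {𝕜 E : Type*} [RCLike 𝕜]
    [NormedAddCommGroup E] [InnerProductSpace 𝕜 E] [NormedSpace ℝ E] [IsScalarTower ℝ 𝕜 E]
    {u v : ℝ → E} {u' : E} {d : 𝕜} {t : ℝ} (hu : HasDerivAt u u' t) (hv : ContinuousAt v t)
    (hd : HasDerivAt (fun s => inner 𝕜 (u t) (v s)) d t) :
    HasDerivAt (fun s => inner 𝕜 (u s) (v s)) (inner 𝕜 u' (v t) + d) t := by
  rw [hasDerivAt_iff_tendsto_slope] at hu hd ⊢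
  have hslope : Tendsto (fun s => inner 𝕜 (slope u t s) (v s)) (𝓝[≠] t) (𝓝 (inner 𝕜 u' (v t))) :=
    hu.inner (hv.tendsto.mono_left nhdsWithin_le_nhds)
  refine (hslope.add hd).congr fun s => ?_
  rw [slope_def_module, slope_def_module, slope_def_module, RCLike.real_smul_eq_coe_smul (K := 𝕜),
    inner_smul_real_left, inner_sub_left, ← smul_add, sub_add_sub_cancel]

variable {ħ : ℝ} {R : Matrix (Fin n ⊕ Fin n) (Fin n ⊕ Fin n) ℝ}

/-- A curve of Schwartz functions along which Schrödinger's equation holds strongly, i.e. with the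
time derivative taken in the norm of `L²`. -/
def IsStrongSolution (ħ : ℝ) (R : Matrix (Fin n ⊕ Fin n) (Fin n ⊕ Fin n) ℝ)
    (g : ℝ → 𝓢(ConfigSpace n, ℂ)) : Prop :=
  ∀ t, HasDerivAt (fun s => (g s).toLp 2 (volume : Measure (ConfigSpace n)))
    ((Complex.I * (ħ : ℂ))⁻¹ • (weylHamiltonian ħ R (g t)).toLp 2 volume) t

theorem IsStrongSolution.isSchrodingerSolution {g : ℝ → 𝓢(ConfigSpace n, ℂ)}
    (hg : IsStrongSolution ħ R g) :
    IsSchrodingerSolution ħ R fun s => (g s).toLp 2 volume := by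
  refine ⟨continuous_iff_continuousAt.2 fun t => (hg t).continuousAt, fun φ t => ?_⟩
  have h := (hasDerivAt_const t (φ.toLp 2 (volume : Measure (ConfigSpace n)))).inner ℂ (hg t)
  refine h.congr_deriv ?_
  rw [inner_smul_right, inner_zero_left, add_zero, inner_weylHamiltonian]

theorem IsStrongSolution.comp_sub {g : ℝ → 𝓢(ConfigSpace n, ℂ)} (hg : IsStrongSolution ħ R g)
    (T : ℝ) : IsStrongSolution ħ R fun s => g (s - T) :=
  fun t => (hg (t - T)).comp_sub_const t T

theorem IsStrongSolution.inner_eq {g : ℝ → 𝓢(ConfigSpace n, ℂ)} (hg : IsStrongSolution ħ R g)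
    {Ψ : ℝ → StateSpace n} (hΨ : IsSchrodingerSolution ħ R Ψ) (s t : ℝ) :
    inner ℂ ((g s).toLp 2 volume) (Ψ s) = inner ℂ ((g t).toLp 2 volume) (Ψ t) := by
  have hderiv (t : ℝ) : HasDerivAt (fun s => inner ℂ ((g s).toLp 2 volume) (Ψ s)) 0 t := by
    refine (hasDerivAt_inner_of_hasDerivAt_inner_const (hg t) hΨ.1.continuousAt
      (hΨ.2 (g t) t)).congr_deriv ?_
    rw [inner_smul_left, ← add_mul, map_inv₀, map_mul, Complex.conj_I, Complex.conj_ofReal,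
      neg_mul, inv_neg, neg_add_cancel, zero_mul]
  exact is_const_of_deriv_eq_zero (fun s => (hderiv s).differentiableAt)
    (fun s => (hderiv s).deriv) s t

theorem isStrongSolution_evolvedWave {M : Matrix (Fin n) (Fin n) ℂ} (hħ : 0 < ħ) (hR : R.IsSymm)
    (c : ℂ) (hM : IsSiegel M) (z : PhaseSpace n) :
    IsStrongSolution ħ R (evolvedWave hħ hR c hM z) :=
  hasDerivAt_toLp_evolvedWave hħ hR c hM z

end WeakSolutions

section Uniqueness

open scoped FourierTransform ContDiff

theorem ae_eq_zero_of_fourier_eq_zero {V : Type*} [NormedAddCommGroup V] [InnerProductSpace ℝ V]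
    [FiniteDimensional ℝ V] [MeasurableSpace V] [BorelSpace V] {h : V → ℂ} (h_int : Integrable h)
    (hzero : ∀ w, 𝓕 h w = 0) : h =ᵐ[volume] 0 := by
  refine ae_eq_zero_of_integral_contDiff_smul_eq_zero h_int.locallyIntegrable fun g hg hgs => ?_
  have hsupp : HasCompactSupport (Complex.ofRealCLM ∘ g) := hgs.comp_left rfl
  have hsmooth : ContDiff ℝ ∞ (Complex.ofRealCLM ∘ g) := by fun_prop
  set G : 𝓢(V, ℂ) := hsupp.toSchwartzMap hsmooth
  set ψ : 𝓢(V, ℂ) := 𝓕⁻ G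
  have hparseval : ∫ ξ, 𝓕 (ψ : V → ℂ) ξ * h ξ = ∫ x, ψ x * 𝓕 h x := by
    simpa using! VectorFourier.integral_bilin_fourierIntegral_eq_flip (ContinuousLinearMap.mul ℂ ℂ)
      (L := innerₗ V) Real.continuous_fourierChar continuous_inner ψ.integrable h_int
  have hinversion : 𝓕 (ψ : V → ℂ) = G := by
    rw [← SchwartzMap.fourier_coe, FourierTransform.fourier_fourierInv_eq]
  simp only [hinversion, hzero, mul_zero, integral_zero] at hparseval
  rw [← hparseval]
  refine integral_congr_ae (Filter.Eventually.of_forall fun x => ?_)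
  simp [G]

theorem eq_zero_of_inner_modulation_eq_zero {V : Type*} [NormedAddCommGroup V]
    [InnerProductSpace ℝ V] [FiniteDimensional ℝ V] [MeasurableSpace V] [BorelSpace V]
    {φ : 𝓢(V, ℂ)} {modulation : V → 𝓢(V, ℂ)}
    (hmod : ∀ p x, modulation p x = Complex.exp (Complex.I * (inner ℝ p x : ℝ)) * φ x)
    (hφ : ∀ x, φ x ≠ 0) {f : Lp ℂ 2 (volume : Measure V)}
    (hf : ∀ p, inner ℂ ((modulation p).toLp 2 volume) f = 0) : f = 0 := by
  have h_int : Integrable fun x => (starRingEnd ℂ) (φ x) * f x := by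
    refine (L2.integrable_inner (𝕜 := ℂ) (φ.toLp 2 volume) f).congr ?_
    filter_upwards [SchwartzMap.coeFn_toLp φ 2 volume] with x hx
    rw [hx, RCLike.inner_apply']
  have hfourier (w : V) : 𝓕 (fun x => (starRingEnd ℂ) (φ x) * f x) w = 0 := by
    rw [Real.fourier_eq', ← hf ((2 * Real.pi) • w), L2.inner_def]
    refine integral_congr_ae ?_
    filter_upwards [SchwartzMap.coeFn_toLp (modulation ((2 * Real.pi) • w)) 2 volume] with x hx
    rw [hx, RCLike.inner_apply', hmod, map_mul, ← Complex.exp_conj, smul_eq_mul,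
      ← mul_assoc (Complex.exp _), map_mul, Complex.conj_I, Complex.conj_ofReal,
      real_inner_smul_left, real_inner_comm w x]
    congr 3
    push_cast
    ring
  rw [Lp.eq_zero_iff_ae_eq_zero]
  filter_upwards [ae_eq_zero_of_fourier_eq_zero h_int hfourier] with x hx
  exact (mul_eq_zero.1 hx).resolve_left ((map_ne_zero _).2 (hφ x))

variable {ħ : ℝ} (hħ : 0 < ħ) {M : Matrix (Fin n) (Fin n) ℂ}
  {R : Matrix (Fin n ⊕ Fin n) (Fin n ⊕ Fin n) ℝ}

theorem toComplexVec_dotProduct {ι : Type*} [Fintype ι] (u v : EuclideanSpace ℝ ι) :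
    toComplexVec u.ofLp ⬝ᵥ toComplexVec v.ofLp = (inner ℝ u v : ℝ) := by
  simp [inner_eq_dotProduct, dotProduct, toComplexVec]

theorem coherentWave_eq_exp_mul_of_position_eq_zero (c : ℂ) (hM : IsSiegel M) {z : PhaseSpace n}
    (hz : position z = 0) (x : ConfigSpace n) :
    coherentWave hħ c hM z x =
      Complex.exp (Complex.I / ħ * (inner ℝ (momentum z) x : ℝ)) * coherentWave hħ c hM 0 x := by
  have h0 : (toComplexVec (0 : ConfigSpace n).ofLp) = 0 := by ext; simp [toComplexVec]
  have hp : position (0 : PhaseSpace n) = 0 := rfl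
  have hm : momentum (0 : PhaseSpace n) = 0 := rfl
  rw [coherentWave_apply, coherentWave_apply, ← Complex.exp_add, ← toComplexVec_dotProduct]
  simp only [coherentCoefficients, gaussianExponent_apply, linearCoefficient_eq ħ hM.1, hz, hp, hm,
    h0, Matrix.mulVec_zero, zero_add, smul_zero, zero_dotProduct, mul_zero, sub_zero, add_zero,
    smul_dotProduct, smul_eq_mul]
  congr 1
  ring

theorem eq_zero_of_inner_coherentWave_eq_zero (c : ℂ) (hM : IsSiegel M) {f : StateSpace n}
    (hf : ∀ z, inner ℂ ((coherentWave hħ c hM z).toLp 2 volume) f = 0) : f = 0 := by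
  let z (p : ConfigSpace n) : PhaseSpace n := WithLp.toLp 2 (Sum.elim 0 (ħ • p).ofLp)
  refine eq_zero_of_inner_modulation_eq_zero (φ := coherentWave hħ c hM 0)
    (modulation := fun p => coherentWave hħ c hM (z p))
    (fun p x => ?_) (fun x => ?_) fun p => hf (z p)
  · have hmomentum : momentum (z p) = ħ • p := rfl
    have hħ' : (ħ : ℂ) ≠ 0 := by exact_mod_cast hħ.ne'
    rw [coherentWave_eq_exp_mul_of_position_eq_zero hħ c hM (z := z p) rfl, hmomentum,
      real_inner_smul_left]
    push_cast
    rw [← mul_assoc, div_mul_cancel₀ _ hħ']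
  · exact Complex.exp_ne_zero _

theorem IsSchrodingerSolution.unique (hħ : 0 < ħ) (hR : R.IsSymm) {Ψ Ψ' : ℝ → StateSpace n}
    (hΨ : IsSchrodingerSolution ħ R Ψ) (hΨ' : IsSchrodingerSolution ħ R Ψ')
    (h0 : Ψ 0 = Ψ' 0) : Ψ = Ψ' := by
  funext T
  rw [← sub_eq_zero]
  have hM := isSiegel_complexCovariance (Matrix.PosDef.one (n := Fin n) (R := ℝ)) Matrix.isSymm_zero
  refine eq_zero_of_inner_coherentWave_eq_zero hħ 0 hM fun z => ?_
  have hg := (isStrongSolution_evolvedWave hħ hR 0 hM z).comp_sub T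
  have hgT : evolvedWave hħ hR 0 hM z (T - T) = coherentWave hħ 0 hM z := by
    rw [sub_self, evolvedWave_zero]
  rw [inner_sub_right, ← hgT, hg.inner_eq hΨ T 0, hg.inner_eq hΨ' T 0, h0, sub_self]

end Uniqueness

/-! ### Normalization -/

section Normalization

theorem complexCovariance_mulVec_dotProduct {ι : Type*} [Fintype ι] [DecidableEq ι]
    (X Y : Matrix ι ι ℝ) (v : EuclideanSpace ℝ ι) :
    (complexCovariance X Y *ᵥ toComplexVec v.ofLp) ⬝ᵥ toComplexVec v.ofLp =
      (quadForm X v : ℂ) + Complex.I * (quadForm Y v : ℂ) := by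
  rw [complexCovariance, Matrix.add_mulVec, Matrix.smul_mulVec, toComplex_mulVec_toComplexVec,
    toComplex_mulVec_toComplexVec, add_dotProduct, smul_dotProduct, smul_eq_mul]
  simp [quadForm, dotProduct, toComplexVec]

variable {ħ : ℝ} (hħ : 0 < ħ)

theorem coherentState_eq_coherentWave {X Y : Matrix (Fin n) (Fin n) ℝ} (hX : X.PosDef)
    (hY : Y.IsSymm) (z : PhaseSpace n) (γ : ℝ) :
    coherentState ħ X Y z γ = coherentWave hħ (Real.log (gaussianAmplitude ħ X) +
      Complex.I / ħ * γ) (isSiegel_complexCovariance hX hY) z := by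
  have hM := (isSiegel_complexCovariance hX hY).1
  funext x
  have hamplitude : (gaussianAmplitude ħ X : ℂ) =
      Complex.exp (Real.log (gaussianAmplitude ħ X)) := by
    rw [← Complex.ofReal_exp, Real.exp_log (gaussianAmplitude_pos hħ hX.det_pos)]
  have hsub : toComplexVec (x - position z).ofLp =
      toComplexVec x.ofLp - toComplexVec (position z).ofLp := by
    ext j
    simp [toComplexVec]
  have hcross := dotProduct_mulVec_symm hM (toComplexVec x.ofLp) (toComplexVec (position z).ofLp)
  rw [coherentState, heisenbergWeyl, squeezedGaussian, ← gaussianAmplitude.eq_1, hamplitude,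
    ← complexCovariance_mulVec_dotProduct, hsub, coherentWave_apply, coherentCoefficients,
    gaussianExponent_apply, linearCoefficient_eq ħ hM, ← Complex.exp_add, ← Complex.exp_add,
    ← Complex.exp_add]
  congr 1
  rw [Complex.ofReal_sub, Complex.ofReal_mul, ← toComplexVec_dotProduct, ← toComplexVec_dotProduct]
  simp only [Matrix.mulVec_sub, sub_dotProduct, dotProduct_sub, smul_dotProduct, add_dotProduct,
    dotProduct_smul, dotProduct_add, smul_eq_mul]
  push_cast
  linear_combination (1 / (2 * ħ : ℂ)) * (hcross -
    dotProduct_comm (complexCovariance X Y *ᵥ toComplexVec (position z).ofLp)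
      (toComplexVec x.ofLp) +
    dotProduct_comm (toComplexVec (position z).ofLp)
      (complexCovariance X Y *ᵥ toComplexVec (position z).ofLp) +
    Complex.I * dotProduct_comm (toComplexVec (position z).ofLp) (toComplexVec (momentum z).ofLp))

theorem inner_toLp_self {V : Type*} [NormedAddCommGroup V] [InnerProductSpace ℝ V]
    [FiniteDimensional ℝ V] [MeasurableSpace V] [BorelSpace V] (φ : 𝓢(V, ℂ)) :
    inner ℂ (φ.toLp 2 (volume : Measure V)) (φ.toLp 2 volume) = ((∫ x, ‖φ x‖ ^ 2 : ℝ) : ℂ) := by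
  refine (SchwartzMap.inner_toL2_toL2_eq φ φ volume).trans ?_
  rw [← integral_complex_ofReal]
  refine integral_congr_ae (Filter.Eventually.of_forall fun x => ?_)
  simp only [RCLike.inner_apply, Complex.mul_conj, Complex.normSq_eq_norm_sq]

variable {M : Matrix (Fin n) (Fin n) ℂ}

theorem coherentWave_eq_exp_sub_mul (c c' : ℂ) (hM : IsSiegel M) (z : PhaseSpace n)
    (x : ConfigSpace n) :
    coherentWave hħ c hM z x = Complex.exp (c - c') * coherentWave hħ c' hM z x := by
  rw [coherentWave_apply, coherentWave_apply, ← Complex.exp_add]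
  congr 1
  simp only [coherentCoefficients, gaussianExponent_apply]
  ring

/-- Normalization pins down the real part of the logarithmic amplitude `c`; its imaginary part is
the phase of the coherent state. -/
theorem exists_coherentWave_eq_coherentState {c : ℂ} (hM : IsSiegel M) (z : PhaseSpace n)
    (hnorm : ∫ x, ‖coherentWave hħ c hM z x‖ ^ 2 = 1) :
    ∃ γ : ℝ, (coherentWave hħ c hM z : ConfigSpace n → ℂ) =
      coherentState ħ (M.map Complex.re) (M.map Complex.im) z γ := by
  have hY : (M.map Complex.im).IsSymm := hM.1.map _
  set l : ℝ := Real.log (gaussianAmplitude ħ (M.map Complex.re))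
  have hstate (γ : ℝ) : coherentState ħ (M.map Complex.re) (M.map Complex.im) z γ =
      coherentWave hħ (l + Complex.I / ħ * γ) hM z := by
    rw [coherentState_eq_coherentWave hħ hM.2 hY]
    simp only [complexCovariance_re_im]
    rfl
  have hre : c.re = l := by
    simp_rw [coherentWave_eq_exp_sub_mul hħ c (l + Complex.I / ħ * (0 : ℝ)) hM z, ← hstate,
      norm_mul, mul_pow] at hnorm
    rw [integral_const_mul, integral_norm_sq_coherentState hħ hM.2 hY, mul_one, Complex.norm_exp,
      ← Real.exp_nat_mul, Real.exp_eq_one_iff] at hnorm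
    simpa [sub_eq_zero] using hnorm
  have hc : l + Complex.I / ħ * (ħ * c.im : ℝ) = c := by
    have hħ' : (ħ : ℂ) ≠ 0 := by exact_mod_cast hħ.ne'
    rw [← hre, Complex.ofReal_mul, ← mul_assoc, div_mul_cancel₀ _ hħ', mul_comm, Complex.re_add_im]
  exact ⟨ħ * c.im, by rw [hstate, hc]⟩

theorem integral_norm_sq_evolvedWave {R : Matrix (Fin n ⊕ Fin n) (Fin n ⊕ Fin n) ℝ}
    (hR : R.IsSymm) (c : ℂ) (hM : IsSiegel M) (z : PhaseSpace n) (t : ℝ) :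
    ∫ x, ‖evolvedWave hħ hR c hM z t x‖ ^ 2 = ∫ x, ‖coherentWave hħ c hM z x‖ ^ 2 := by
  have hsol := isStrongSolution_evolvedWave hħ hR c hM z
  have hconst := hsol.inner_eq hsol.isSchrodingerSolution t 0
  rwa [inner_toLp_self, inner_toLp_self, Complex.ofReal_inj, evolvedWave_zero] at hconst

end Normalization

/-! ### The correspondence -/

section Correspondence

variable {ħ : ℝ}

theorem image_setOf_quadForm_le {ι : Type*} [Fintype ι] [DecidableEq ι] {S : Matrix ι ι ℝ}
    (hS : IsUnit S.det) (A : Matrix ι ι ℝ) (z₀ : EuclideanSpace ℝ ι) (r : ℝ) :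
    Matrix.toEuclideanLin S '' {z | quadForm A (z - z₀) ≤ r} =
      {z | quadForm ((S⁻¹)ᵀ * A * S⁻¹) (z - Matrix.toEuclideanLin S z₀) ≤ r} := by
  ext z
  simp only [Set.mem_image, Set.mem_ofPred_eq, quadForm_congr, map_sub,
    ← toEuclideanLin_mul_apply, Matrix.nonsing_inv_mul _ hS, Matrix.toLpLin_one,
    LinearMap.id_apply]
  constructor
  · rintro ⟨u, hu, rfl⟩
    simpa [← toEuclideanLin_mul_apply, Matrix.nonsing_inv_mul _ hS] using hu
  · intro h
    exact ⟨_, h, by simp [← toEuclideanLin_mul_apply, Matrix.mul_nonsing_inv _ hS]⟩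

theorem exists_quantumBlob_eq_setOf_blobMatrix {X Y : Matrix (Fin n) (Fin n) ℝ} (hħ : 0 ≤ ħ)
    (hX : X.PosDef) (hY : Y.IsSymm) (z₀ : PhaseSpace n) :
    ∃ S ∈ Matrix.symplecticGroup (Fin n) ℝ,
      quantumBlob ħ z₀ S = {z | quadForm (blobMatrix X Y) (z - z₀) ≤ ħ} := by
  obtain ⟨L, hL, hblob⟩ := exists_mem_symplecticGroup_blobMatrix_eq hX hY
  have hLinv := inv_mem_symplecticGroup hL
  refine ⟨L⁻¹, hLinv, ?_⟩
  rw [quantumBlob_eq_setOf_quadForm_le hħ z₀ (isUnit_det_of_mem_symplecticGroup hLinv),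
    Matrix.nonsing_inv_nonsing_inv _ (isUnit_det_of_mem_symplecticGroup hL), hblob]

theorem exists_blobMatrix_eq_of_mem_symplecticGroup
    {S : Matrix (Fin n ⊕ Fin n) (Fin n ⊕ Fin n) ℝ} (hS : S ∈ Matrix.symplecticGroup (Fin n) ℝ) :
    ∃ X Y : Matrix (Fin n) (Fin n) ℝ, X.PosDef ∧ Y.IsSymm ∧ blobMatrix X Y = (S⁻¹)ᵀ * S⁻¹ := by
  have hM := isSiegel_complexCovariance (Matrix.PosDef.one (n := Fin n) (R := ℝ)) Matrix.isSymm_zero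
  have hSM := isSiegel_siegelAction hS hM
  refine ⟨_, _, hSM.2, hSM.1.map Complex.im, ?_⟩
  rw [blobMatrix_siegelAction hS hM, map_re_complexCovariance, map_im_complexCovariance,
    blobMatrix_one_zero, mul_one]

theorem IsSqueezedCoherentState.exists_correspondsTo_iff_eq_quantumBlob (hħ : 0 < ħ)
    {ψ : StateSpace n} (hψ : IsSqueezedCoherentState ħ ψ) :
    ∃ z₀, ∃ S ∈ Matrix.symplecticGroup (Fin n) ℝ,
      ∀ Q, CorrespondsTo ħ ψ Q ↔ Q = quantumBlob ħ z₀ S := by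
  obtain ⟨X, Y, z₀, γ, hX, hY, hψ⟩ := hψ
  obtain ⟨S, hS, hblob⟩ := exists_quantumBlob_eq_setOf_blobMatrix hħ.le hX hY z₀
  exact ⟨z₀, S, hS, fun Q => hblob ▸ correspondsTo_iff_of_ae_eq_coherentState hħ hX hY hψ⟩

theorem toLp_coherentWave_ae_eq_coherentState {X Y : Matrix (Fin n) (Fin n) ℝ} (hħ : 0 < ħ)
    (hX : X.PosDef) (hY : Y.IsSymm) (z₀ : PhaseSpace n) (γ : ℝ) :
    (coherentWave hħ (Real.log (gaussianAmplitude ħ X) + Complex.I / ħ * γ)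
      (isSiegel_complexCovariance hX hY) z₀).toLp 2 volume =ᵐ[volume]
        coherentState ħ X Y z₀ γ :=
  (SchwartzMap.coeFn_toLp _ 2 volume).trans
    (.of_eq (coherentState_eq_coherentWave hħ hX hY z₀ γ).symm)

theorem exists_isSqueezedCoherentState_correspondsTo (hħ : 0 < ħ) (z₀ : PhaseSpace n)
    {S : Matrix (Fin n ⊕ Fin n) (Fin n ⊕ Fin n) ℝ} (hS : S ∈ Matrix.symplecticGroup (Fin n) ℝ) :
    ∃ ψ : StateSpace n, IsSqueezedCoherentState ħ ψ ∧ CorrespondsTo ħ ψ (quantumBlob ħ z₀ S) := by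
  obtain ⟨X, Y, hX, hY, hblob⟩ := exists_blobMatrix_eq_of_mem_symplecticGroup hS
  have hψ := toLp_coherentWave_ae_eq_coherentState hħ hX hY z₀ 0
  refine ⟨_, ⟨X, Y, z₀, 0, hX, hY, hψ⟩,
    (correspondsTo_iff_of_ae_eq_coherentState hħ hX hY hψ).2 ?_⟩
  rw [quantumBlob_eq_setOf_quadForm_le hħ.le z₀ (isUnit_det_of_mem_symplecticGroup hS), hblob]

theorem isSqueezedCoherentState_toLp_coherentWave (hħ : 0 < ħ) {c : ℂ}
    {M : Matrix (Fin n) (Fin n) ℂ} (hM : IsSiegel M) (z₀ : PhaseSpace n)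
    (hnorm : ∫ x, ‖coherentWave hħ c hM z₀ x‖ ^ 2 = 1) :
    IsSqueezedCoherentState ħ ((coherentWave hħ c hM z₀).toLp 2 volume) := by
  obtain ⟨γ, hγ⟩ := exists_coherentWave_eq_coherentState hħ hM z₀ hnorm
  exact ⟨_, _, z₀, γ, hM.2, hM.1.map _, (SchwartzMap.coeFn_toLp _ 2 volume).trans (.of_eq hγ)⟩

theorem correspondsTo_toLp_coherentWave_iff (hħ : 0 < ħ) {c : ℂ}
    {M : Matrix (Fin n) (Fin n) ℂ} (hM : IsSiegel M) (z₀ : PhaseSpace n)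
    (hnorm : ∫ x, ‖coherentWave hħ c hM z₀ x‖ ^ 2 = 1) {Q : Set (PhaseSpace n)} :
    CorrespondsTo ħ ((coherentWave hħ c hM z₀).toLp 2 volume) Q ↔
      Q = {z | quadForm (blobMatrix (M.map Complex.re) (M.map Complex.im)) (z - z₀) ≤ ħ} := by
  obtain ⟨γ, hγ⟩ := exists_coherentWave_eq_coherentState hħ hM z₀ hnorm
  exact correspondsTo_iff_of_ae_eq_coherentState hħ hM.2 (hM.1.map _)
    ((SchwartzMap.coeFn_toLp _ 2 volume).trans (.of_eq hγ))

variable {R : Matrix (Fin n ⊕ Fin n) (Fin n ⊕ Fin n) ℝ}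

theorem isSqueezedCoherentState_toLp_evolvedWave (hħ : 0 < ħ) (hR : R.IsSymm) {c : ℂ}
    {M : Matrix (Fin n) (Fin n) ℂ} (hM : IsSiegel M) (z₀ : PhaseSpace n)
    (hnorm : ∫ x, ‖coherentWave hħ c hM z₀ x‖ ^ 2 = 1) (t : ℝ) :
    IsSqueezedCoherentState ħ ((evolvedWave hħ hR c hM z₀ t).toLp 2 volume) :=
  isSqueezedCoherentState_toLp_coherentWave hħ _ _
    ((integral_norm_sq_evolvedWave hħ hR c hM z₀ t).trans hnorm)

theorem correspondsTo_toLp_evolvedWave_iff (hħ : 0 < ħ) (hR : R.IsSymm) {c : ℂ}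
    {M : Matrix (Fin n) (Fin n) ℂ} (hM : IsSiegel M) (z₀ : PhaseSpace n)
    (hnorm : ∫ x, ‖coherentWave hħ c hM z₀ x‖ ^ 2 = 1) (t : ℝ) {Q : Set (PhaseSpace n)} :
    CorrespondsTo ħ ((evolvedWave hħ hR c hM z₀ t).toLp 2 volume) Q ↔
      Q = Matrix.toEuclideanLin (classicalFlow R t) ''
        {z | quadForm (blobMatrix (M.map Complex.re) (M.map Complex.im)) (z - z₀) ≤ ħ} := by
  have hSt := classicalFlow_mem_symplecticGroup hR t
  rw [evolvedWave, correspondsTo_toLp_coherentWave_iff hħ _ _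
      ((integral_norm_sq_evolvedWave hħ hR c hM z₀ t).trans hnorm),
    blobMatrix_siegelAction hSt hM,
    image_setOf_quadForm_le (isUnit_det_of_mem_symplecticGroup hSt)]

theorem IsSqueezedCoherentState.exists_isSchrodingerSolution (hħ : 0 < ħ) (hR : R.IsSymm)
    {ψ : StateSpace n} (hψ : IsSqueezedCoherentState ħ ψ) :
    ∃ Ψ : ℝ → StateSpace n, IsSchrodingerSolution ħ R Ψ ∧ Ψ 0 = ψ ∧ ∀ t,
      IsSqueezedCoherentState ħ (Ψ t) ∧ ∀ Q₀, CorrespondsTo ħ ψ Q₀ → ∀ Q,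
        CorrespondsTo ħ (Ψ t) Q ↔ Q = Matrix.toEuclideanLin (classicalFlow R t) '' Q₀ := by
  obtain ⟨X, Y, z₀, γ, hX, hY, hψ⟩ := hψ
  have hM := isSiegel_complexCovariance hX hY
  set c : ℂ := Real.log (gaussianAmplitude ħ X) + Complex.I / ħ * γ
  have hnorm : ∫ x, ‖coherentWave hħ c hM z₀ x‖ ^ 2 = 1 := by
    rw [← integral_norm_sq_coherentState hħ hX hY z₀ γ, coherentState_eq_coherentWave hħ hX hY z₀ γ]
  refine ⟨fun t => (evolvedWave hħ hR c hM z₀ t).toLp 2 volume,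
    (isStrongSolution_evolvedWave hħ hR c hM z₀).isSchrodingerSolution, ?_, fun t =>
    ⟨isSqueezedCoherentState_toLp_evolvedWave hħ hR hM z₀ hnorm t, fun Q₀ hQ₀ Q => ?_⟩⟩
  · simp only [evolvedWave_zero]
    exact Lp.ext ((toLp_coherentWave_ae_eq_coherentState hħ hX hY z₀ γ).trans hψ.symm)
  · rw [correspondsTo_toLp_evolvedWave_iff hħ hR hM z₀ hnorm t, map_re_complexCovariance,
      map_im_complexCovariance, (correspondsTo_iff_of_ae_eq_coherentState hħ hX hY hψ).1 hQ₀]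

end Correspondence

end QuantumBlobs

end

theorem mainTheorem4 (n : ℕ) (hn : 1 ≤ n) (ħ : ℝ) (hħ : 0 < ħ)
    (R : Matrix (Fin n ⊕ Fin n) (Fin n ⊕ Fin n) ℝ) (hR : R.IsSymm) :
    -- the matrices `S_t` are symplectic and are the flow of Hamilton's equations
    (∀ t : ℝ, QuantumBlobs.classicalFlow R t ∈ Matrix.symplecticGroup (Fin n) ℝ) ∧
    (∀ z : ℝ → QuantumBlobs.PhaseSpace n,
      QuantumBlobs.IsHamiltonTrajectory (QuantumBlobs.quadraticHamiltonian R) z ↔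
        ∀ t : ℝ, z t = Matrix.toEuclideanLin (QuantumBlobs.classicalFlow R t) (z 0)) ∧
    -- every squeezed coherent state has exactly one corresponding set, which is a quantum blob
    (∀ Ψ₀ : QuantumBlobs.StateSpace n, QuantumBlobs.IsSqueezedCoherentState ħ Ψ₀ →
      ∃ (z₀ : QuantumBlobs.PhaseSpace n) (S₀ : Matrix (Fin n ⊕ Fin n) (Fin n ⊕ Fin n) ℝ),
        S₀ ∈ Matrix.symplecticGroup (Fin n) ℝ ∧
        ∀ Q : Set (QuantumBlobs.PhaseSpace n),
          QuantumBlobs.CorrespondsTo ħ Ψ₀ Q ↔ Q = QuantumBlobs.quantumBlob ħ z₀ S₀) ∧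
    -- every quantum blob corresponds to some squeezed coherent state
    (∀ (z₀ : QuantumBlobs.PhaseSpace n) (S₀ : Matrix (Fin n ⊕ Fin n) (Fin n ⊕ Fin n) ℝ),
      S₀ ∈ Matrix.symplecticGroup (Fin n) ℝ →
      ∃ Ψ₀ : QuantumBlobs.StateSpace n, QuantumBlobs.IsSqueezedCoherentState ħ Ψ₀ ∧
        QuantumBlobs.CorrespondsTo ħ Ψ₀ (QuantumBlobs.quantumBlob ħ z₀ S₀)) ∧
    -- the quantum motion of the state induces the classical motion of the blob
    (∀ (z : ℝ → QuantumBlobs.PhaseSpace n) (S₀ : Matrix (Fin n ⊕ Fin n) (Fin n ⊕ Fin n) ℝ)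
      (Ψ₀ : QuantumBlobs.StateSpace n),
      QuantumBlobs.IsHamiltonTrajectory (QuantumBlobs.quadraticHamiltonian R) z →
      S₀ ∈ Matrix.symplecticGroup (Fin n) ℝ →
      QuantumBlobs.IsSqueezedCoherentState ħ Ψ₀ →
      QuantumBlobs.CorrespondsTo ħ Ψ₀ (QuantumBlobs.quantumBlob ħ (z 0) S₀) →
      ∃ Ψ : ℝ → QuantumBlobs.StateSpace n,
        QuantumBlobs.IsSchrodingerSolution ħ R Ψ ∧ Ψ 0 = Ψ₀ ∧
        (∀ Ψ' : ℝ → QuantumBlobs.StateSpace n,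
          QuantumBlobs.IsSchrodingerSolution ħ R Ψ' → Ψ' 0 = Ψ₀ → Ψ' = Ψ) ∧
        ∀ t : ℝ,
          QuantumBlobs.IsSqueezedCoherentState ħ (Ψ t) ∧
          (∀ Q : Set (QuantumBlobs.PhaseSpace n),
            QuantumBlobs.CorrespondsTo ħ (Ψ t) Q ↔
              Q = Matrix.toEuclideanLin (QuantumBlobs.classicalFlow R t) ''
                QuantumBlobs.quantumBlob ħ (z 0) S₀) ∧
          Matrix.toEuclideanLin (QuantumBlobs.classicalFlow R t) ''
              QuantumBlobs.quantumBlob ħ (z 0) S₀ =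
            QuantumBlobs.quantumBlob ħ (z t) (QuantumBlobs.classicalFlow R t * S₀)) := by
  refine ⟨QuantumBlobs.classicalFlow_mem_symplecticGroup hR,
    QuantumBlobs.isHamiltonTrajectory_iff_classicalFlow hR, fun Ψ₀ hΨ₀ => ?_,
    fun z₀ S₀ hS₀ => QuantumBlobs.exists_isSqueezedCoherentState_correspondsTo hħ z₀ hS₀,
    fun z S₀ Ψ₀ hz _ hΨ₀ hQ => ?_⟩
  · exact hΨ₀.exists_correspondsTo_iff_eq_quantumBlob hħ
  · obtain ⟨Ψ, hΨ, h0, hstate⟩ := hΨ₀.exists_isSchrodingerSolution hħ hR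
    refine ⟨Ψ, hΨ, h0, fun Ψ' hΨ' h0' => hΨ'.unique hħ hR hΨ (h0'.trans h0.symm), fun t =>
      ⟨(hstate t).1, (hstate t).2 _ hQ, ?_⟩⟩
    rw [QuantumBlobs.image_quantumBlob,
      ← (QuantumBlobs.isHamiltonTrajectory_iff_classicalFlow hR z).1 hz t]
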